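/- Let $G$ be a locally compact (Hausdorff) group with a fixed left Haar measure, and let $S^1(G)$ be a Segal algebra in $L^1(G)$: a dense left ideal of the convolution algebra $L^1(G)$ that is invariant under the left translations $L_xf(y)=f(x^{-1}y)$, carries a complete norm $\|\cdot\|_{S}$ for which the inclusion $S^1(G)\hookrightarrow L^1(G)$ is continuous and $\|f*s\|_S\le\|f\|_1\|s\|_S$ $(f\in L^1(G),\,s\in S^1(G))$, and is essential, i.e. the linear span of $L^1(G)*S^1(G)$ is $\|\cdot\|_S$-dense in $S^1(G)$. Call $S^1(G)$ symmetric if it is moreover a right ideal of $L^1(G)$ with $\|s*f\|_S\le\|s\|_S\|f\|_1$ and the linear span of $S^1(G)*L^1(G)$ is $\|\cdot\|_S$-dense in $S^1(G)$. Let $\widehat\otimes$ denote the projective tensor product of Banach spaces. On $L^1(G)\widehat\otimes S^1(G)$ (and likewise on $S^1(G)\widehat\otimes S^1(G)$) put $f\cdot(g\otimes s)=(f*g)\otimes s$, $(g\otimes s)\cdot t=g\otimes(s*t)$ and $\pi(g\otimes s)=g*s$. A central approximate diagonal for $S^1(G)$ in $L^1(G)\widehat\otimes S^1(G)$ is a net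 $(m_\gamma)$ in $L^1(G)\widehat\otimes S^1(G)$ such that $s\cdot m_\gamma=m_\gamma\cdot s$ for all $\gamma$ and all $s\in S^1(G)$, and $(\pi(m_\gamma))$ is an approximate identity for $S^1(G)$; it is multiplier-bounded if the operators $s\mapsto s\cdot m_\gamma$ and $s\mapsto m_\gamma\cdot s$ from $S^1(G)$ to $L^1(G)\widehat\otimes S^1(G)$ are bounded uniformly in $\gamma$. The algebra $S^1(G)$ is pseudo-contractible if there is a net $(m_\gamma)$ in $S^1(G)\widehat\otimes S^1(G)$ with $s\cdot m_\gamma=m_\gamma\cdot s$ and $\pi(m_\gamma)*s\to s$ in $S^1(G)$ for all $s\in S^1(G)$. If $S^1(G)$ is symmetric, it is called a projective $L^1(G)$-bimodule if there is a bounded $L^1(G)$-bimodule map $\rho:S^1(G)\to L^1(G)\widehat\otimes S^1(G)$ with $\pi\circ\rho=\mathrm{id}_{S^1(G)}$. Then the following are equivalent: (i) $G$ is compact; (ii) $S^1(G)$ has a central approximate diagonal in $L^1(G)\widehat\otimes S^1(G)$; (iii) $S^1(G)$ is pseudo-contractible. If, in addition, $S^1(G)$ is symmetric, then these statements are also equivalent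 to each of the following: (iv) $S^1(G)$ is a projective $L^1(G)$-bimodule; (v) $S^1(G)$ has a central multiplier-bounded approximate diagonal in $L^1(G)\widehat\otimes S^1(G)$. -/

import Mathlib

open MeasureTheory Filter Topology
open scoped TensorProduct ENNReal

/-! ### The projective tensor product of Banach spaces -/

section ProjectiveTensor

/-- The algebraic tensor product `E ⊗ F`, to be equipped with the projective norm. -/
def AlgTensor (E F : Type*) [NormedAddCommGroup E] [NormedSpace ℂ E]
    [NormedAddCommGroup F] [NormedSpace ℂ F] : Type _ := E ⊗[ℂ] F

namespace AlgTensor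

variable {E F X : Type*} [NormedAddCommGroup E] [NormedSpace ℂ E]
  [NormedAddCommGroup F] [NormedSpace ℂ F] [NormedAddCommGroup X] [NormedSpace ℂ X]

noncomputable instance : AddCommGroup (AlgTensor E F) :=
  inferInstanceAs (AddCommGroup (E ⊗[ℂ] F))

noncomputable instance : Module ℂ (AlgTensor E F) :=
  inferInstanceAs (Module ℂ (E ⊗[ℂ] F))

/-- The elementary tensor `x ⊗ y`. -/
noncomputable def tmul (x : E) (y : F) : AlgTensor E F := x ⊗ₜ[ℂ] y

/-- The value `∑ x_i ⊗ y_i` of a finite list of pairs `(x_i, y_i)`. -/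
noncomputable def listSum (l : List (E × F)) : AlgTensor E F :=
  (l.map fun p => tmul p.1 p.2).sum

/-- The cost `∑ ‖x_i‖ ‖y_i‖` of a finite list of pairs `(x_i, y_i)`. -/
noncomputable def listCost (l : List (E × F)) : ℝ :=
  (l.map fun p => ‖p.1‖ * ‖p.2‖).sum

theorem listCost_nonneg (l : List (E × F)) : 0 ≤ listCost l := by
  refine List.sum_nonneg fun a ha => ?_
  obtain ⟨p, -, rfl⟩ := List.mem_map.1 ha
  positivity

theorem exists_listSum (t : AlgTensor E F) : ∃ l : List (E × F), listSum l = t := by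
  induction t using TensorProduct.induction_on with
  | zero => exact ⟨[], rfl⟩
  | tmul x y => exact ⟨[(x, y)], add_zero _⟩
  | add a b ha hb =>
    obtain ⟨l, rfl⟩ := ha
    obtain ⟨l', rfl⟩ := hb
    exact ⟨l ++ l', by simp only [listSum, List.map_append, List.sum_append]; rfl⟩

instance (t : AlgTensor E F) : Nonempty {l : List (E × F) // listSum l = t} :=
  let ⟨l, hl⟩ := exists_listSum t; ⟨⟨l, hl⟩⟩

/-- The projective norm `‖t‖ = inf ∑ ‖x_i‖ ‖y_i‖` over all representations `t = ∑ x_i ⊗ y_i`. -/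
noncomputable instance : Norm (AlgTensor E F) :=
  ⟨fun t => ⨅ l : {l : List (E × F) // listSum l = t}, listCost l.1⟩

theorem norm_le_listCost (l : List (E × F)) : ‖listSum l‖ ≤ listCost l :=
  ciInf_le (f := fun k : {k : List (E × F) // listSum k = listSum l} => listCost k.1)
    ⟨0, by rintro _ ⟨k, rfl⟩; exact listCost_nonneg _⟩ ⟨l, rfl⟩

theorem le_norm {t : AlgTensor E F} {c : ℝ} (h : ∀ l, listSum l = t → c ≤ listCost l) :
    c ≤ ‖t‖ := le_ciInf fun l => h l.1 l.2

theorem norm_zero' : ‖(0 : AlgTensor E F)‖ = 0 :=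
  le_antisymm (by simpa [listSum, listCost] using norm_le_listCost ([] : List (E × F)))
    (le_norm fun l _ => listCost_nonneg l)

theorem norm_add_le' (s t : AlgTensor E F) : ‖s + t‖ ≤ ‖s‖ + ‖t‖ := by
  refine le_ciInf_add_ciInf fun l k => ?_
  have h : listSum (l.1 ++ k.1) = s + t := by
    simp only [listSum, List.map_append, List.sum_append]
    exact congrArg₂ (· + ·) l.2 k.2
  have h' : listCost (l.1 ++ k.1) = listCost l.1 + listCost k.1 := by simp [listCost]
  rw [← h, ← h']
  exact norm_le_listCost _

theorem norm_smul_le' (a : ℂ) (t : AlgTensor E F) : ‖a • t‖ ≤ ‖a‖ * ‖t‖ := by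
  change _ ≤ ‖a‖ * ⨅ l : {l : List (E × F) // listSum l = t}, listCost l.1
  rw [Real.mul_iInf_of_nonneg (norm_nonneg _)]
  refine le_ciInf fun l => ?_
  have h : listSum (l.1.map fun p => (a • p.1, p.2)) = a • t := by
    obtain ⟨l, rfl⟩ := l
    simp only [listSum, List.map_map, List.smul_sum]
    rfl
  have h' : listCost (l.1.map fun p => (a • p.1, p.2)) = ‖a‖ * listCost l.1 := by
    simp [listCost, Function.comp_def, norm_smul, mul_assoc, List.sum_map_mul_left]
  rw [← h, ← h']
  exact norm_le_listCost _

noncomputable def projSeminorm : Seminorm ℂ (AlgTensor E F) :=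
  .ofSMulLE norm norm_zero' norm_add_le' norm_smul_le'

noncomputable instance : SeminormedAddCommGroup (AlgTensor E F) :=
  AddGroupSeminorm.toSeminormedAddCommGroup projSeminorm.toAddGroupSeminorm

noncomputable instance : NormedSpace ℂ (AlgTensor E F) := ⟨norm_smul_le'⟩

theorem norm_tmul_le (x : E) (y : F) : ‖tmul x y‖ ≤ ‖x‖ * ‖y‖ := by
  simpa [listSum, listCost] using norm_le_listCost [(x, y)]

/-- The linear map `E ⊗ F → X` induced by a bounded bilinear map. -/
noncomputable def liftLinear (B : E →L[ℂ] F →L[ℂ] X) : AlgTensor E F →ₗ[ℂ] X :=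
  let L : E ⊗[ℂ] F →ₗ[ℂ] X := TensorProduct.lift
    (LinearMap.mk₂ ℂ (fun x y => B x y) (by simp) (by simp) (by simp) (by simp))
  { toFun := fun t => L t
    map_add' := fun s t => L.map_add s t
    map_smul' := fun a t => L.map_smul a t }

theorem liftLinear_tmul (B : E →L[ℂ] F →L[ℂ] X) (x : E) (y : F) :
    liftLinear B (tmul x y) = B x y := rfl

theorem norm_liftLinear_le (B : E →L[ℂ] F →L[ℂ] X) (t : AlgTensor E F) :
    ‖liftLinear B t‖ ≤ ‖B‖ * ‖t‖ := by
  have key : ∀ l : List (E × F), ‖liftLinear B (listSum l)‖ ≤ ‖B‖ * listCost l := by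
    intro l
    induction l with
    | nil =>
      have h : (listSum [] : AlgTensor E F) = 0 := rfl
      rw [h, map_zero]
      simp [listCost]
    | cons p l ih =>
      have h1 : (listSum (p :: l) : AlgTensor E F) = tmul p.1 p.2 + listSum l := rfl
      have h2 : listCost (p :: l) = ‖p.1‖ * ‖p.2‖ + listCost l := by simp [listCost]
      rw [h1, h2, map_add, mul_add, liftLinear_tmul, ← mul_assoc]
      exact (norm_add_le _ _).trans (add_le_add (B.le_opNorm₂ p.1 p.2) ih)
  have h : ‖B‖ * ‖t‖
      = ‖B‖ * ⨅ l : {l : List (E × F) // listSum l = t}, listCost l.1 := rfl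
  rw [h, Real.mul_iInf_of_nonneg (norm_nonneg B)]
  refine le_ciInf fun l => ?_
  have := key l.1
  rwa [l.2] at this

/-- The linear map `E ⊗ F → X` induced by a bounded bilinear map, bounded for the projective
norm. -/
noncomputable def lift (B : E →L[ℂ] F →L[ℂ] X) : AlgTensor E F →L[ℂ] X :=
  (liftLinear B).mkContinuous ‖B‖ (norm_liftLinear_le B)

@[simp] theorem lift_tmul (B : E →L[ℂ] F →L[ℂ] X) (x : E) (y : F) :
    lift B (tmul x y) = B x y := rfl

end AlgTensor

/-- The projective tensor product `E ⊗̂ F`: the completion of `E ⊗ F` in the projective norm. -/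
abbrev ProjTensor (E F : Type*) [NormedAddCommGroup E] [NormedSpace ℂ E]
    [NormedAddCommGroup F] [NormedSpace ℂ F] : Type _ :=
  UniformSpace.Completion (AlgTensor E F)

namespace ProjTensor

variable {E F E' F' X : Type*} [NormedAddCommGroup E] [NormedSpace ℂ E]
  [NormedAddCommGroup F] [NormedSpace ℂ F] [NormedAddCommGroup E'] [NormedSpace ℂ E']
  [NormedAddCommGroup F'] [NormedSpace ℂ F']
  [NormedAddCommGroup X] [NormedSpace ℂ X] [CompleteSpace X]

/-- The elementary tensor `x ⊗ y` in `E ⊗̂ F`. -/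
noncomputable def tmul (x : E) (y : F) : ProjTensor E F := (AlgTensor.tmul x y : AlgTensor E F)

theorem tmul_add (x : E) (y y' : F) : tmul x (y + y') = tmul x y + tmul x y' := by
  have h : AlgTensor.tmul x (y + y') = AlgTensor.tmul x y + AlgTensor.tmul x y' :=
    TensorProduct.tmul_add x y y'
  simp only [tmul, h, UniformSpace.Completion.coe_add]

theorem add_tmul (x x' : E) (y : F) : tmul (x + x') y = tmul x y + tmul x' y := by
  have h : AlgTensor.tmul (x + x') y = AlgTensor.tmul x y + AlgTensor.tmul x' y :=
    TensorProduct.add_tmul x x' y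
  simp only [tmul, h, UniformSpace.Completion.coe_add]

theorem smul_tmul (a : ℂ) (x : E) (y : F) : tmul (a • x) y = a • tmul x y := by
  have h : AlgTensor.tmul (a • x) y = a • AlgTensor.tmul x y := rfl
  simp only [tmul, h, UniformSpace.Completion.coe_smul]

theorem tmul_smul (a : ℂ) (x : E) (y : F) : tmul x (a • y) = a • tmul x y := by
  have h : AlgTensor.tmul x (a • y) = a • AlgTensor.tmul x y := TensorProduct.tmul_smul a x y
  simp only [tmul, h, UniformSpace.Completion.coe_smul]

theorem norm_tmul_le (x : E) (y : F) : ‖tmul x y‖ ≤ 1 * ‖x‖ * ‖y‖ := by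
  rw [one_mul]
  exact (UniformSpace.Completion.norm_coe (AlgTensor.tmul x y)).trans_le
    (AlgTensor.norm_tmul_le x y)

/-- The bounded bilinear map `(x, y) ↦ x ⊗ y`. -/
noncomputable def tmulL : E →L[ℂ] F →L[ℂ] ProjTensor E F :=
  LinearMap.mkContinuous₂ (LinearMap.mk₂ ℂ tmul add_tmul smul_tmul tmul_add tmul_smul) 1
    norm_tmul_le

/-- The bounded linear map `E ⊗̂ F → X` with `x ⊗ y ↦ B x y`. -/
noncomputable def lift (B : E →L[ℂ] F →L[ℂ] X) : ProjTensor E F →L[ℂ] X :=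
  (AlgTensor.lift B).extend UniformSpace.Completion.toComplL

@[simp] theorem lift_tmul (B : E →L[ℂ] F →L[ℂ] X) (x : E) (y : F) :
    lift B (tmul x y) = B x y := by
  rw [← AlgTensor.lift_tmul B x y]
  exact ContinuousLinearMap.extend_eq _ UniformSpace.Completion.denseRange_coe
    (UniformSpace.Completion.isUniformInducing_coe _) _

/-- The bounded linear map `T ⊗ U : E ⊗̂ F → E' ⊗̂ F'`. -/
noncomputable def map (T : E →L[ℂ] E') (U : F →L[ℂ] F') : ProjTensor E F →L[ℂ] ProjTensor E' F' :=
  lift (tmulL.bilinearComp T U)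

@[simp] theorem map_tmul (T : E →L[ℂ] E') (U : F →L[ℂ] F') (x : E) (y : F) :
    map T U (tmul x y) = tmul (T x) (U y) := by
  rw [map, lift_tmul]
  rfl

end ProjTensor

end ProjectiveTensor

/-! ### Pseudo-contractible Banach algebras -/

section PseudoContractible

universe u

/-- A Banach algebra, given as a Banach space `A` with a bounded multiplication `mul`, is
pseudo-contractible: there is a net `(m γ)` in `A ⊗̂ A` with `a · m γ = m γ · a` and
`π (m γ) a → a` for all `a`, where `a · (b ⊗ c) = (a b) ⊗ c`, `(b ⊗ c) · a = b ⊗ (c a)` and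
`π (b ⊗ c) = b c`. -/
def IsPseudoContractible {A : Type u} [NormedAddCommGroup A] [NormedSpace ℂ A] [CompleteSpace A]
    (mul : A →L[ℂ] A →L[ℂ] A) : Prop :=
  ∃ (Γ : Type u) (_ : Preorder Γ) (_ : IsDirectedOrder Γ) (_ : Nonempty Γ)
    (m : Γ → ProjTensor A A),
    (∀ γ a, ProjTensor.map (mul a) (ContinuousLinearMap.id ℂ A) (m γ)
      = ProjTensor.map (ContinuousLinearMap.id ℂ A) (mul.flip a) (m γ)) ∧
    ∀ a, Tendsto (fun γ => mul (ProjTensor.lift mul (m γ)) a) atTop (𝓝 a)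

end PseudoContractible

/-! ### The group algebra -/

section GroupAlgebra

variable {G : Type*} [Group G] [TopologicalSpace G] [IsTopologicalGroup G]
  [LocallyCompactSpace G] [MeasurableSpace G] [BorelSpace G]
  (μ : Measure G) [μ.IsHaarMeasure] [μ.Regular]

/-- The space `L¹(G)` with respect to the left Haar measure `μ`. -/
abbrev LOne : Type _ := Lp ℂ 1 μ

variable {μ}

/-- The left translation `(L_x f)(y) = f (x⁻¹ y)` on `L¹(G)`. -/
noncomputable def leftTranslate (x : G) (f : LOne μ) : LOne μ :=
  DomMulAct.mk x⁻¹ • f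

theorem leftTranslate_ae_eq (x : G) (f : LOne μ) :
    leftTranslate x f =ᵐ[μ] fun y => f (x⁻¹ * y) :=
  DomMulAct.smul_Lp_ae_eq _ f

theorem norm_leftTranslate (x : G) (f : LOne μ) : ‖leftTranslate x f‖ = ‖f‖ :=
  DomMulAct.norm_smul_Lp _ f

theorem continuous_leftTranslate (f : LOne μ) : Continuous fun x : G => leftTranslate x f := by
  have : Fact ((1 : ℝ≥0∞) ≠ ∞) := ⟨ENNReal.one_ne_top⟩
  have h : Continuous fun x : G => DomMulAct.mk x⁻¹ :=
    DomMulAct.continuous_mk.comp continuous_inv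
  exact h.smul continuous_const

theorem aestronglyMeasurable_smul_continuous {X : Type*} [NormedAddCommGroup X] [NormedSpace ℂ X]
    {f : G → ℂ} (hf : Integrable f μ) {φ : G → X} (hφ : Continuous φ) :
    AEStronglyMeasurable (fun y => f y • φ y) μ := by
  refine Integrable.induction (μ := μ)
    (fun f : G → ℂ => AEStronglyMeasurable (fun y => f y • φ y) μ) ?_ ?_ ?_ ?_ hf
  · intro c s hs hsμ
    have h : (fun y => s.indicator (fun _ => c) y • φ y) = s.indicator fun y => c • φ y := by
      ext y
      by_cases hy : y ∈ s <;> simp [hy]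
    rw [h, aestronglyMeasurable_indicator_iff hs]
    have hne : ∀ n : ℕ, ((n : ℝ≥0∞) + 1)⁻¹ ≠ 0 := fun n => by simp
    choose K hKs hKc hKcl hK using fun n : ℕ =>
      hs.exists_isCompact_isClosed_sdiff_lt hsμ.ne (hne n)
    have hlim : Tendsto (fun n : ℕ => ((n : ℝ≥0∞) + 1)⁻¹) atTop (𝓝 0) := by
      have := (tendsto_add_atTop_iff_nat 1).2 ENNReal.tendsto_inv_nat_nhds_zero
      simpa using this
    have h0 : μ (s \ ⋃ n, K n) = 0 := by
      refine le_antisymm (ge_of_tendsto' hlim fun n => ?_) zero_le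
      exact (measure_mono (Set.sdiff_subset_sdiff_right (Set.subset_iUnion K n))).trans (hK n).le
    have hae : s =ᵐ[μ] ⋃ n, K n :=
      (ae_le_set.2 h0).antisymm (LE.le.eventuallyLE (Set.iUnion_subset hKs))
    rw [Measure.restrict_congr_set hae, aestronglyMeasurable_iUnion_iff]
    intro n
    exact ContinuousOn.aestronglyMeasurable_of_isCompact (by fun_prop) (hKc n)
      (hKcl n).measurableSet
  · intro f g _ _ _ h1 h2
    simp only [Pi.add_apply, add_smul]
    exact h1.add h2
  · refine IsSeqClosed.isClosed fun u v hu huv => ?_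
    obtain ⟨ns, -, hns⟩ := (tendstoInMeasure_of_tendsto_Lp huv).exists_seq_tendsto_ae
    refine aestronglyMeasurable_of_tendsto_ae atTop (fun n => hu (ns n)) ?_
    filter_upwards [hns] with y hy
    exact hy.smul_const _
  · intro f g hfg _ h
    refine h.congr ?_
    filter_upwards [hfg] with y hy
    rw [hy]

theorem integrable_smul_leftTranslate (f g : LOne μ) :
    Integrable (fun y => f y • leftTranslate y g) μ := by
  have hmeas : AEStronglyMeasurable (fun y => f y • leftTranslate y g) μ :=
    aestronglyMeasurable_smul_continuous (L1.integrable_coeFn f) (continuous_leftTranslate g)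
  refine Integrable.mono' ((L1.integrable_coeFn f).norm.mul_const ‖g‖) hmeas ?_
  filter_upwards with y
  rw [norm_smul, norm_leftTranslate]

/-- The convolution product on `L¹(G)`, `f * g = ∫ f(y) L_y g dy`, i.e.
`(f * g)(x) = ∫ f(y) g(y⁻¹ x) dy`, as a bounded bilinear map. -/
noncomputable def conv : LOne μ →L[ℂ] LOne μ →L[ℂ] LOne μ :=
  LinearMap.mkContinuous₂
    (LinearMap.mk₂ ℂ (fun f g : LOne μ => ∫ y, f y • leftTranslate y g ∂μ)
      (fun f f' g => by
        rw [← integral_add (integrable_smul_leftTranslate f g)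
          (integrable_smul_leftTranslate f' g)]
        refine integral_congr_ae ?_
        filter_upwards [Lp.coeFn_add f f'] with y hy
        rw [hy, Pi.add_apply, add_smul])
      (fun c f g => by
        rw [← integral_smul]
        refine integral_congr_ae ?_
        filter_upwards [Lp.coeFn_smul c f] with y hy
        rw [hy, Pi.smul_apply, smul_assoc])
      (fun f g g' => by
        rw [← integral_add (integrable_smul_leftTranslate f g)
          (integrable_smul_leftTranslate f g')]
        refine integral_congr_ae (Eventually.of_forall fun y => ?_)
        simp [leftTranslate, smul_add])
      (fun c f g => by
        rw [← integral_smul]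
        refine integral_congr_ae (Eventually.of_forall fun y => ?_)
        simp only [leftTranslate]
        rw [smul_comm _ c g, smul_comm _ c]))
    1 (fun f g => by
      change ‖∫ y, f y • leftTranslate y g ∂μ‖ ≤ _
      refine (norm_integral_le_integral_norm _).trans (le_of_eq ?_)
      simp only [norm_smul, norm_leftTranslate, one_mul]
      rw [integral_mul_const, ← L1.norm_eq_integral_norm f])

theorem conv_apply (f g : LOne μ) : conv f g = ∫ y, f y • leftTranslate y g ∂μ := rfl

end GroupAlgebra

/-! ### Segal algebras in `L¹(G)` -/

section Segal

universe u v

variable {G : Type u} [Group G] [TopologicalSpace G] [IsTopologicalGroup G]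
  [LocallyCompactSpace G] [MeasurableSpace G] [BorelSpace G]
  {μ : Measure G} [μ.IsHaarMeasure] [μ.Regular]
  {S : Type v} [NormedAddCommGroup S] [NormedSpace ℂ S]

/-- The Banach space `S`, identified through the inclusion `ι` with a linear subspace of `L¹(G)`
carrying its own norm, is a Segal algebra: a dense left ideal which is a contractive and
essential left `L¹(G)`-module in its norm, and which is invariant under left translations. -/
structure IsSegalAlgebra (ι : S →L[ℂ] LOne μ) : Prop where
  injective : Function.Injective ι
  denseRange : DenseRange ι
  left_ideal : ∀ (f : LOne μ) (s : S), ∃ t : S, ι t = conv f (ι s) ∧ ‖t‖ ≤ ‖f‖ * ‖s‖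
  essential : Dense (Submodule.span ℂ {t : S | ∃ f s, ι t = conv f (ι s)} : Set S)
  translation : ∀ (x : G) (s : S), ∃ t : S, ι t = leftTranslate x (ι s)

/-- The Segal algebra `S` is symmetric: it is also a right ideal, and a contractive and essential
right `L¹(G)`-module in its norm. -/
structure IsSymmetricSegalAlgebra (ι : S →L[ℂ] LOne μ) : Prop extends IsSegalAlgebra ι where
  right_ideal : ∀ (s : S) (f : LOne μ), ∃ t : S, ι t = conv (ι s) f ∧ ‖t‖ ≤ ‖s‖ * ‖f‖
  right_essential : Dense (Submodule.span ℂ {t : S | ∃ s f, ι t = conv (ι s) f} : Set S)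

namespace IsSegalAlgebra

variable {ι : S →L[ℂ] LOne μ}

/-- The product `f * s ∈ S` of `f ∈ L¹(G)` and `s ∈ S`. -/
noncomputable def leftProd (h : IsSegalAlgebra ι) (f : LOne μ) (s : S) : S :=
  (h.left_ideal f s).choose

theorem leftProd_spec (h : IsSegalAlgebra ι) (f : LOne μ) (s : S) :
    ι (h.leftProd f s) = conv f (ι s) :=
  (h.left_ideal f s).choose_spec.1

/-- The left module action `(f, s) ↦ f * s` of `L¹(G)` on `S`. -/
noncomputable def leftAct (h : IsSegalAlgebra ι) : LOne μ →L[ℂ] S →L[ℂ] S :=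
  LinearMap.mkContinuous₂
    (LinearMap.mk₂ ℂ h.leftProd
      (fun f f' s => h.injective (by simp [leftProd_spec]))
      (fun c f s => h.injective (by simp [leftProd_spec]))
      (fun f s s' => h.injective (by simp [leftProd_spec]))
      (fun c f s => h.injective (by simp [leftProd_spec])))
    1 (fun f s => by
      rw [one_mul]
      exact (h.left_ideal f s).choose_spec.2)

theorem leftAct_spec (h : IsSegalAlgebra ι) (f : LOne μ) (s : S) :
    ι (h.leftAct f s) = conv f (ι s) :=
  h.leftProd_spec f s

/-- The convolution product of the algebra `S`. -/
noncomputable def mul (h : IsSegalAlgebra ι) : S →L[ℂ] S →L[ℂ] S := h.leftAct.comp ι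

/-- The product map `π : L¹(G) ⊗̂ S → S`, `f ⊗ s ↦ f * s`. -/
noncomputable def prodMap [CompleteSpace S] (h : IsSegalAlgebra ι) :
    ProjTensor (LOne μ) S →L[ℂ] S :=
  ProjTensor.lift h.leftAct

/-- The left action `f · (g ⊗ s) = (f * g) ⊗ s` of `L¹(G)` on `L¹(G) ⊗̂ S`. -/
noncomputable def tensorLeft (_h : IsSegalAlgebra ι) (f : LOne μ) :
    ProjTensor (LOne μ) S →L[ℂ] ProjTensor (LOne μ) S :=
  ProjTensor.map (conv f) (ContinuousLinearMap.id ℂ S)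

/-- The right action `(g ⊗ s) · t = g ⊗ (s * t)` of `S` on `L¹(G) ⊗̂ S`. -/
noncomputable def tensorRight (h : IsSegalAlgebra ι) (t : S) :
    ProjTensor (LOne μ) S →L[ℂ] ProjTensor (LOne μ) S :=
  ProjTensor.map (ContinuousLinearMap.id ℂ (LOne μ)) (h.mul.flip t)

/-- The net `(m γ)` is a central approximate diagonal for `S` in `L¹(G) ⊗̂ S`:
`s · m γ = m γ · s` for all `γ` and `s`, and `(π (m γ))` is an approximate identity for `S`. -/
def IsCentralApproximateDiagonal [CompleteSpace S] (h : IsSegalAlgebra ι) {Γ : Type*}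
    [Preorder Γ] (m : Γ → ProjTensor (LOne μ) S) : Prop :=
  (∀ γ s, h.tensorLeft (ι s) (m γ) = h.tensorRight s (m γ)) ∧
  (∀ s, Tendsto (fun γ => h.mul (h.prodMap (m γ)) s) atTop (𝓝 s)) ∧
  (∀ s, Tendsto (fun γ => h.mul s (h.prodMap (m γ))) atTop (𝓝 s))

/-- `S` has a central approximate diagonal in `L¹(G) ⊗̂ S`. -/
def HasCentralApproximateDiagonal [CompleteSpace S] (h : IsSegalAlgebra ι) : Prop :=
  ∃ (Γ : Type v) (_ : Preorder Γ) (_ : IsDirectedOrder Γ) (_ : Nonempty Γ)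
    (m : Γ → ProjTensor (LOne μ) S), h.IsCentralApproximateDiagonal m

/-- `S` has a central multiplier-bounded approximate diagonal in `L¹(G) ⊗̂ S`: the operators
`s ↦ s · m γ` and `s ↦ m γ · s` from `S` to `L¹(G) ⊗̂ S` are uniformly bounded. -/
def HasCentralMultiplierBoundedApproximateDiagonal [CompleteSpace S] (h : IsSegalAlgebra ι) :
    Prop :=
  ∃ (Γ : Type v) (_ : Preorder Γ) (_ : IsDirectedOrder Γ) (_ : Nonempty Γ)
    (m : Γ → ProjTensor (LOne μ) S), h.IsCentralApproximateDiagonal m ∧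
    ∃ C : ℝ, ∀ γ s, ‖h.tensorLeft (ι s) (m γ)‖ ≤ C * ‖s‖ ∧ ‖h.tensorRight s (m γ)‖ ≤ C * ‖s‖

end IsSegalAlgebra

namespace IsSymmetricSegalAlgebra

variable {ι : S →L[ℂ] LOne μ}

/-- The product `s * f ∈ S` of `s ∈ S` and `f ∈ L¹(G)`; the arguments are in the order `f`, `s`. -/
noncomputable def rightProd (h : IsSymmetricSegalAlgebra ι) (f : LOne μ) (s : S) : S :=
  (h.right_ideal s f).choose

theorem rightProd_spec (h : IsSymmetricSegalAlgebra ι) (f : LOne μ) (s : S) :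
    ι (h.rightProd f s) = conv (ι s) f :=
  (h.right_ideal s f).choose_spec.1

/-- The right module action of `L¹(G)` on a symmetric Segal algebra: `h.rightAct f s = s * f`. -/
noncomputable def rightAct (h : IsSymmetricSegalAlgebra ι) : LOne μ →L[ℂ] S →L[ℂ] S :=
  LinearMap.mkContinuous₂
    (LinearMap.mk₂ ℂ h.rightProd
      (fun f f' s => h.injective (by simp [rightProd_spec]))
      (fun c f s => h.injective (by simp [rightProd_spec]))
      (fun f s s' => h.injective (by simp [rightProd_spec]))
      (fun c f s => h.injective (by simp [rightProd_spec])))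
    1 (fun f s => by
      rw [one_mul, mul_comm]
      exact (h.right_ideal s f).choose_spec.2)

theorem rightAct_spec (h : IsSymmetricSegalAlgebra ι) (f : LOne μ) (s : S) :
    ι (h.rightAct f s) = conv (ι s) f :=
  h.rightProd_spec f s

/-- `S` is a projective `L¹(G)`-bimodule: the product map `π : L¹(G) ⊗̂ S → S` has a bounded right
inverse `ρ` that is an `L¹(G)`-bimodule map, where `f · (g ⊗ s) = (f * g) ⊗ s` and
`(g ⊗ s) · f = g ⊗ (s * f)`. -/
def IsProjectiveBimodule [CompleteSpace S] (h : IsSymmetricSegalAlgebra ι) : Prop :=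
  ∃ ρ : S →L[ℂ] ProjTensor (LOne μ) S,
    (∀ f s, ρ (h.leftAct f s) = h.tensorLeft f (ρ s)) ∧
    (∀ f s, ρ (h.rightAct f s)
      = ProjTensor.map (ContinuousLinearMap.id ℂ (LOne μ)) (h.rightAct f) (ρ s)) ∧
    ∀ s, h.prodMap (ρ s) = s

end IsSymmetricSegalAlgebra

end Segal

/-!
The augmentation `f ↦ ∫ f` is a character of `L¹(G)`. Applied to the second leg of a central
approximate diagonal, or to that of a bimodule splitting of `π`, it produces a nonzero `g ∈ L¹(G)`
with `f * g = (∫ f) g` for every `f`; such a `g` is left invariant, which forces `G` to be compact.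

Conversely, let `G` be compact. The tensors `∫ L_{z⁻¹}u ⊗ L_z v dz` satisfy
`f · ∫ L_{z⁻¹}u ⊗ L_z v dz = ∫ L_{z⁻¹}u ⊗ L_z (f * v) dz`, and as `u` runs through central bumps
shrinking to the identity they converge to `ρ v` for a splitting `ρ` of `π`. If `(u_γ)` is a central
approximate identity of `S` that is bounded in `L¹(G)`, then `(ρ u_γ)` is a central
multiplier-bounded approximate diagonal, and multiplying its first leg by `u_γ` moves it into
`S ⊗̂ S`. Such a net exists: for a hermitian continuous class function `w`, convolution by `w` is a
compact self-adjoint operator on the central part of `L²(G)`, so `w * w` is a limit of sums of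
central eigenvectors. The eigenspace of a nonzero eigenvalue in `L¹(G)` is a finite-dimensional
ideal, and therefore it lies in the dense left ideal `S`.
-/

section PointwiseLimits

variable {ι E F : Type*} [NormedAddCommGroup E] [NormedSpace ℂ E] [NormedAddCommGroup F]
  [NormedSpace ℂ F] {l : Filter ι} {T : ι → E →L[ℂ] F} {C : ℝ}

theorem tendsto_apply_of_eventually_norm_le (hT : ∀ᶠ i in l, ‖T i‖ ≤ C) {x : ι → E} {a : E} {b : F}
    (hx : Tendsto x l (𝓝 a)) (ha : Tendsto (fun i => T i a) l (𝓝 b)) :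
    Tendsto (fun i => T i (x i)) l (𝓝 b) := by
  have hdiff : Tendsto (fun i => T i (x i - a)) l (𝓝 0) := by
    refine squeeze_zero_norm' (hT.mono fun i hi => (T i).le_of_opNorm_le hi _) ?_
    simpa using (hx.sub_const a).norm.const_mul C
  simpa using hdiff.add ha

variable [l.NeBot] [CompleteSpace F] {D : Set E}

theorem exists_tendsto_of_dense (hT : ∀ᶠ i in l, ‖T i‖ ≤ C) (hD : Dense D)
    (hlim : ∀ x ∈ D, ∃ y, Tendsto (fun i => T i x) l (𝓝 y)) (x : E) :
    ∃ y, Tendsto (fun i => T i x) l (𝓝 y) := by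
  refine cauchy_map_iff_exists_tendsto.1 (cauchy_map_iff'.2 ?_)
  refine Metric.uniformity_basis_dist.tendsto_right_iff.2 fun ε hε => ?_
  obtain ⟨C', hC', hC⟩ : ∃ C' > 0, C ≤ C' := ⟨max C 1, by positivity, le_max_left C 1⟩
  obtain ⟨d, hdD, hd⟩ := hD.exists_dist_lt x (div_pos hε (mul_pos three_pos hC'))
  obtain ⟨y, hy⟩ := hlim d hdD
  have hcauchy := (cauchy_map_iff'.1 hy.cauchy_map).eventually
    (Metric.dist_mem_uniformity (div_pos hε three_pos))
  have hnear : ∀ᶠ i in l, dist (T i x) (T i d) < ε / 3 := hT.mono fun i hi => by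
    rw [dist_eq_norm, ← map_sub]
    calc ‖T i (x - d)‖ ≤ C' * ‖x - d‖ := (T i).le_of_opNorm_le (hi.trans hC) _
      _ < C' * (ε / (3 * C')) := by rw [← dist_eq_norm]; gcongr
      _ = ε / 3 := by field_simp
  filter_upwards [hcauchy, hnear.prod_mk hnear] with ⟨i, j⟩ hij hxd
  have := dist_triangle4_right (T i x) (T j x) (T i d) (T j d)
  simp only at hij hxd ⊢
  linarith [hxd.1, hxd.2]

theorem exists_clm_tendsto_of_dense (hT : ∀ᶠ i in l, ‖T i‖ ≤ C) (hD : Dense D)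
    (hlim : ∀ x ∈ D, ∃ y, Tendsto (fun i => T i x) l (𝓝 y)) :
    ∃ R : E →L[ℂ] F, ∀ x, Tendsto (fun i => T i x) l (𝓝 (R x)) := by
  choose R hR using exists_tendsto_of_dense hT hD hlim
  refine ⟨(linearMapOfTendsto R (fun i => (T i : E →ₗ[ℂ] F)) (tendsto_pi_nhds.2 hR)).mkContinuous C
    fun x => ?_, hR⟩
  exact le_of_tendsto (hR x).norm (hT.mono fun i hi => (T i).le_of_opNorm_le hi x)

theorem tendsto_apply_of_dense (hT : ∀ᶠ i in l, ‖T i‖ ≤ C) (hD : Dense D) {L : E →L[ℂ] F}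
    (hlim : ∀ x ∈ D, Tendsto (fun i => T i x) l (𝓝 (L x))) (x : E) :
    Tendsto (fun i => T i x) l (𝓝 (L x)) := by
  obtain ⟨R, hR⟩ := exists_clm_tendsto_of_dense hT hD fun x hx => ⟨_, hlim x hx⟩
  have hRL : R = L := ContinuousLinearMap.ext fun x => congrFun (Continuous.ext_on hD R.continuous
    L.continuous fun x hx => tendsto_nhds_unique (hR x) (hlim x hx)) x
  exact hRL ▸ hR x

end PointwiseLimits

namespace ProjTensor

variable {E F E' F' E'' F'' X : Type*} [NormedAddCommGroup E] [NormedSpace ℂ E]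
  [NormedAddCommGroup F] [NormedSpace ℂ F] [NormedAddCommGroup E'] [NormedSpace ℂ E']
  [NormedAddCommGroup F'] [NormedSpace ℂ F'] [NormedAddCommGroup E''] [NormedSpace ℂ E'']
  [NormedAddCommGroup F''] [NormedSpace ℂ F'']
  [NormedAddCommGroup X] [NormedSpace ℂ X]

@[simp] theorem tmulL_apply (x : E) (y : F) : tmulL x y = tmul x y := rfl

theorem ext_clm {T U : ProjTensor E F →L[ℂ] X} (h : ∀ x y, T (tmul x y) = U (tmul x y)) :
    T = U := by
  ext t
  induction t using UniformSpace.Completion.induction_on with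
  | hp => exact isClosed_eq T.continuous U.continuous
  | ih a =>
    obtain ⟨l, rfl⟩ := AlgTensor.exists_listSum a
    induction l with
    | nil =>
      change T ((0 : AlgTensor E F) : ProjTensor E F) = U ((0 : AlgTensor E F) : ProjTensor E F)
      rw [UniformSpace.Completion.coe_zero, map_zero, map_zero]
    | cons p l ih =>
      have hcons : (AlgTensor.listSum (p :: l) : AlgTensor E F)
          = AlgTensor.tmul p.1 p.2 + AlgTensor.listSum l := rfl
      rw [hcons, UniformSpace.Completion.coe_add, map_add, map_add, ih]
      exact congrArg (· + _) (h p.1 p.2)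

theorem map_map (T : E →L[ℂ] E') (U : F →L[ℂ] F') (T' : E' →L[ℂ] E'') (U' : F' →L[ℂ] F'')
    (t : ProjTensor E F) : map T' U' (map T U t) = map (T'.comp T) (U'.comp U) t := by
  have h : (map T' U').comp (map T U) = map (T'.comp T) (U'.comp U) :=
    ext_clm fun x y => by simp
  exact DFunLike.congr_fun h t

section Slice

variable [CompleteSpace E] [CompleteSpace E']

/-- The slice map `E ⊗̂ F → E`, `x ⊗ y ↦ ψ(y) x`, of a bounded functional `ψ` on `F`. -/
noncomputable def slice (ψ : F →L[ℂ] ℂ) : ProjTensor E F →L[ℂ] E :=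
  lift (((ContinuousLinearMap.lsmul ℂ ℂ).flip).bilinearComp (ContinuousLinearMap.id ℂ E) ψ)

@[simp] theorem slice_tmul (ψ : F →L[ℂ] ℂ) (x : E) (y : F) : slice ψ (tmul x y) = ψ y • x := by
  simp [slice]

theorem slice_map (ψ : F' →L[ℂ] ℂ) (T : E →L[ℂ] E') (U : F →L[ℂ] F') (t : ProjTensor E F) :
    slice ψ (map T U t) = T (slice (ψ.comp U) t) := by
  have h : (slice ψ).comp (map T U) = T.comp (slice (ψ.comp U)) :=
    ext_clm fun x y => by simp
  exact DFunLike.congr_fun h t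

theorem slice_smul (c : ℂ) (ψ : F →L[ℂ] ℂ) (t : ProjTensor E F) :
    slice (c • ψ) t = c • slice ψ t := by
  have h : slice (c • ψ) = c • (slice ψ : ProjTensor E F →L[ℂ] E) :=
    ext_clm fun x y => by simp [mul_smul]
  exact DFunLike.congr_fun h t

end Slice

end ProjTensor

section InvariantSets

variable {G : Type*} [Group G] [TopologicalSpace G] [IsTopologicalGroup G]
  [LocallyCompactSpace G] [MeasurableSpace G] [BorelSpace G]
  {μ : Measure G} [μ.IsMulLeftInvariant] [μ.Regular]

theorem compactSpace_of_preimage_mul_left_ae_eq {A : Set G} (hA : MeasurableSet A)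
    (hpos : μ A ≠ 0) (hfin : μ A ≠ ∞) (hinv : ∀ x : G, (x * ·) ⁻¹' A =ᵐ[μ] A) :
    CompactSpace G := by
  have : (μ.restrict A).IsMulLeftInvariant := ⟨fun x => by
    have hx := ((measurePreserving_mul_left μ x).restrict_preimage hA).map_eq
    rwa [Measure.restrict_congr_set (hinv x)] at hx⟩
  have : (μ.restrict A).Regular := Measure.Regular.restrict_of_measure_ne_top hfin
  have : NeZero (μ.restrict A) := ⟨fun h => hpos (Measure.restrict_eq_zero.1 h)⟩
  by_contra hcpt
  rw [not_compactSpace_iff] at hcpt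
  exact hfin ((Measure.restrict_apply_univ A).symm.trans
    (measure_univ_of_isMulLeftInvariant (μ.restrict A)))

end InvariantSets

section Bumps

variable {G : Type*} [MeasurableSpace G] {μ : Measure G}

variable (μ) in
/-- The augmentation character `f ↦ ∫ f` of `L¹(G)`. -/
noncomputable def augmentation : LOne μ →L[ℂ] ℂ := L1.integralCLM' ℂ

theorem augmentation_apply (f : LOne μ) : augmentation μ f = ∫ x, f x ∂μ := by
  rw [augmentation, ← L1.integral_eq' ℂ, L1.integral_eq_integral]

/-- A bump of `L¹(G)` supported in `V`: a function of norm at most one and integral one that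
vanishes almost everywhere outside `V`. -/
structure IsBump (V : Set G) (w : LOne μ) : Prop where
  ae_eq_zero : ∀ᵐ y ∂μ, y ∉ V → w y = 0
  augmentation_eq : augmentation μ w = 1
  norm_le : ‖w‖ ≤ 1

theorem IsBump.mono {V W : Set G} {w : LOne μ} (hw : IsBump V w) (hVW : V ⊆ W) : IsBump W w :=
  ⟨hw.ae_eq_zero.mono fun _ hy hyW => hy fun h => hyW (hVW h), hw.augmentation_eq, hw.norm_le⟩

variable [Group G] [TopologicalSpace G]

variable (μ) in
/-- The filter of bumps whose supports shrink to the identity; convolution along it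
approximates the identity operator. -/
def bumps : Filter (LOne μ) := (𝓝 (1 : G)).lift' fun V => {w | IsBump V w}

theorem eventually_bumps_isBump {V : Set G} (hV : V ∈ 𝓝 (1 : G)) : ∀ᶠ w in bumps μ, IsBump V w :=
  mem_lift' hV

theorem inf_principal_bumps_neBot {A : Set (LOne μ)}
    (hA : ∀ V ∈ 𝓝 (1 : G), ∃ w ∈ A, IsBump V w) : (bumps μ ⊓ 𝓟 A).NeBot := by
  refine inf_principal_neBot_iff.2 fun U hU => ?_
  obtain ⟨V, hV, hVU⟩ := (mem_lift'_sets (h := fun V => {w : LOne μ | IsBump V w})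
    fun _ _ hVW _ hw => hw.mono hVW).1 hU
  obtain ⟨w, hwA, hw⟩ := hA V hV
  exact ⟨w, hVU hw, hwA⟩

theorem eventually_bumps_norm_le_one : ∀ᶠ w in bumps μ, ‖w‖ ≤ 1 :=
  (eventually_bumps_isBump univ_mem).mono fun _ hw => hw.norm_le

theorem tendsto_integral_smul_bumps {X : Type*} [NormedAddCommGroup X] [NormedSpace ℂ X]
    [CompleteSpace X] {Φ : G → X} (hΦ : ContinuousAt Φ 1)
    (hint : ∀ w : LOne μ, Integrable (fun y => w y • Φ y) μ) :
    Tendsto (fun w : LOne μ => ∫ y, w y • Φ y ∂μ) (bumps μ) (𝓝 (Φ 1)) := by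
  refine Metric.nhds_basis_closedBall.tendsto_right_iff.2 fun ε hε => ?_
  have hV : {y | ‖Φ y - Φ 1‖ ≤ ε} ∈ 𝓝 (1 : G) :=
    (hΦ.eventually (Metric.closedBall_mem_nhds (Φ 1) hε)).mono fun _ => mem_closedBall_iff_norm.1
  filter_upwards [eventually_bumps_isBump hV] with w hw
  have hdiff : (∫ y, w y • Φ y ∂μ) - Φ 1 = ∫ y, w y • (Φ y - Φ 1) ∂μ := by
    simp only [smul_sub]
    rw [integral_sub (hint w) ((L1.integrable_coeFn w).smul_const _), integral_smul_const,
      ← augmentation_apply, hw.augmentation_eq, one_smul]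
  rw [mem_closedBall_iff_norm, hdiff]
  calc ‖∫ y, w y • (Φ y - Φ 1) ∂μ‖ ≤ ∫ y, ‖w y‖ * ε ∂μ := by
        refine norm_integral_le_of_norm_le ((L1.integrable_coeFn w).norm.mul_const ε) ?_
        filter_upwards [hw.ae_eq_zero] with y hy
        rw [norm_smul]
        by_cases hyV : ‖Φ y - Φ 1‖ ≤ ε
        · gcongr
        · simp [hy hyV]
    _ = ‖w‖ * ε := by rw [integral_mul_const, ← L1.norm_eq_integral_norm]
    _ ≤ ε := mul_le_of_le_one_left hε.le hw.norm_le

variable [IsTopologicalGroup G] [LocallyCompactSpace G] [BorelSpace G] [μ.IsHaarMeasure]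

theorem exists_isBump {V : Set G} (hV : V ∈ 𝓝 (1 : G)) : ∃ w : LOne μ, IsBump V w := by
  obtain ⟨K, ⟨hK, hKc, hKcl⟩, hsub⟩ := (isCompact_isClosed_basis_nhds (1 : G)).mem_iff.1 hV
  have hpos : 0 < μ.real K :=
    ENNReal.toReal_pos (Measure.measure_pos_of_mem_nhds μ hK).ne' hKc.measure_ne_top
  have hcoe := indicatorConstLp_coeFn (p := 1) (hs := hKcl.measurableSet)
    (hμs := hKc.measure_ne_top (μ := μ)) (c := ((μ.real K)⁻¹ : ℂ))
  refine ⟨indicatorConstLp 1 hKcl.measurableSet hKc.measure_ne_top ((μ.real K)⁻¹ : ℂ),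
    ?_, ?_, ?_⟩
  · filter_upwards [hcoe] with y hy hyV
    rw [hy, Set.indicator_of_notMem fun h => hyV (hsub h)]
  · rw [augmentation_apply, integral_congr_ae hcoe, integral_indicator hKcl.measurableSet,
      setIntegral_const, Complex.real_smul]
    exact mul_inv_cancel₀ (by exact_mod_cast hpos.ne')
  · rw [norm_indicatorConstLp one_ne_zero ENNReal.one_ne_top]
    simp [abs_of_pos hpos, hpos.ne']

instance bumps_neBot : (bumps μ).NeBot := by
  simpa using inf_principal_bumps_neBot (A := Set.univ) fun V hV => by
    simpa using exists_isBump (μ := μ) hV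

end Bumps

section GroupAlgebra

variable {G : Type*} [Group G] [TopologicalSpace G] [IsTopologicalGroup G] [MeasurableSpace G]
  [BorelSpace G] {μ : Measure G} [μ.IsHaarMeasure]

theorem leftTranslate_one (f : LOne μ) : leftTranslate 1 f = f := by
  simp [leftTranslate]

theorem leftTranslate_mul (x y : G) (f : LOne μ) :
    leftTranslate (x * y) f = leftTranslate x (leftTranslate y f) := by
  rw [leftTranslate, leftTranslate, leftTranslate, ← mul_smul, ← DomMulAct.mk_mul, mul_inv_rev]

variable [LocallyCompactSpace G] [μ.Regular]

/-- Left translation as a bounded operator on `L¹(G)`. -/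
noncomputable def leftTranslateL (x : G) : LOne μ →L[ℂ] LOne μ :=
  LinearMap.mkContinuous
    { toFun := leftTranslate x
      map_add' := fun f g => by simp only [leftTranslate, smul_add]
      map_smul' := fun c f => smul_comm _ _ _ }
    1 fun f => by rw [one_mul]; exact (norm_leftTranslate x f).le

@[simp] theorem leftTranslateL_apply (x : G) (f : LOne μ) :
    leftTranslateL x f = leftTranslate x f := rfl

theorem augmentation_leftTranslate (x : G) (f : LOne μ) :
    augmentation μ (leftTranslate x f) = augmentation μ f := by
  rw [augmentation_apply, augmentation_apply, integral_congr_ae (leftTranslate_ae_eq x f)]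
  exact integral_mul_left_eq_self (fun y => f y) x⁻¹

theorem map_conv {X : Type*} [NormedAddCommGroup X] [NormedSpace ℂ X] [CompleteSpace X]
    (T : LOne μ →L[ℂ] X) (f g : LOne μ) :
    T (conv f g) = ∫ y, f y • T (leftTranslate y g) ∂μ := by
  simp only [conv_apply, ← T.integral_comp_comm (integrable_smul_leftTranslate f g), map_smul]

theorem augmentation_conv (f g : LOne μ) :
    augmentation μ (conv f g) = augmentation μ f * augmentation μ g := by
  rw [map_conv]
  simp only [augmentation_leftTranslate, smul_eq_mul]
  rw [integral_mul_const, augmentation_apply f]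

theorem norm_conv_le (f g : LOne μ) : ‖conv f g‖ ≤ ‖f‖ * ‖g‖ := by
  rw [conv_apply]
  refine (norm_integral_le_integral_norm _).trans (le_of_eq ?_)
  simp only [norm_smul, norm_leftTranslate]
  rw [integral_mul_const, ← L1.norm_eq_integral_norm f]

theorem conv_leftTranslate_left (x : G) (f g : LOne μ) :
    conv (leftTranslate x f) g = leftTranslate x (conv f g) := by
  calc conv (leftTranslate x f) g
      = ∫ y, f (x⁻¹ * y) • leftTranslate (x * (x⁻¹ * y)) g ∂μ := by
        rw [conv_apply]
        refine integral_congr_ae ?_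
        filter_upwards [leftTranslate_ae_eq x f] with y hy
        rw [hy, mul_inv_cancel_left]
    _ = ∫ y, f y • leftTranslate (x * y) g ∂μ :=
        integral_mul_left_eq_self (fun y => f y • leftTranslate (x * y) g) x⁻¹
    _ = ∫ y, f y • leftTranslateL x (leftTranslate y g) ∂μ := by
        simp only [leftTranslate_mul, leftTranslateL_apply]
    _ = leftTranslateL x (conv f g) := (map_conv _ f g).symm

theorem conv_assoc (f g h : LOne μ) : conv (conv f g) h = conv f (conv g h) := by
  calc conv (conv f g) h = ∫ y, f y • conv (leftTranslate y g) h ∂μ :=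
        map_conv ((conv (μ := μ)).flip h) f g
    _ = conv f (conv g h) := by simp only [conv_leftTranslate_left, conv_apply f]

theorem compactSpace_of_forall_leftTranslate_eq {n : LOne μ} (hn : n ≠ 0)
    (hinv : ∀ x, leftTranslate x n = n) : CompactSpace G := by
  have hmeas (ε : ℝ) : MeasurableSet {y | ε ≤ ‖n y‖} :=
    measurableSet_le measurable_const (Lp.stronglyMeasurable n).norm.measurable
  obtain ⟨k, hk⟩ : ∃ k : ℕ, μ {y | 1 / ((k : ℝ) + 1) ≤ ‖n y‖} ≠ 0 := by
    by_contra! hnull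
    refine hn ((Lp.eq_zero_iff_ae_eq_zero).2 ?_)
    filter_upwards [ae_all_iff.2 fun k => measure_eq_zero_iff_ae_notMem.1 (hnull k)] with y hy
    by_contra h
    obtain ⟨k, hk⟩ := exists_nat_one_div_lt (norm_pos_iff.2 h)
    exact hy k hk.le
  refine compactSpace_of_preimage_mul_left_ae_eq (hmeas _) hk
    ((L1.integrable_coeFn n).measure_norm_ge_lt_top Nat.one_div_pos_of_nat).ne fun x => ?_
  filter_upwards [leftTranslate_ae_eq x⁻¹ n] with y hy
  rw [hinv, inv_inv] at hy
  exact congrArg (fun c => 1 / ((k : ℝ) + 1) ≤ ‖c‖) hy.symm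

theorem tendsto_conv_bumps (f : LOne μ) : Tendsto (fun w => conv w f) (bumps μ) (𝓝 f) := by
  have h := tendsto_integral_smul_bumps (continuous_leftTranslate f).continuousAt
    fun w => integrable_smul_leftTranslate w f
  rwa [leftTranslate_one] at h

theorem eq_zero_of_forall_conv_eq_zero {k : LOne μ} (h : ∀ f, conv f k = 0) : k = 0 := by
  exact tendsto_nhds_unique (tendsto_conv_bumps k) (by simp only [h, tendsto_const_nhds])

theorem compactSpace_of_forall_conv_eq_smul {n : LOne μ} (hn : n ≠ 0)
    (h : ∀ f, conv f n = augmentation μ f • n) : CompactSpace G := by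
  refine compactSpace_of_forall_leftTranslate_eq hn fun x => ?_
  obtain ⟨w, hw⟩ := exists_isBump (μ := μ) (univ_mem (f := 𝓝 (1 : G)))
  have hwn : conv w n = n := by rw [h, hw.augmentation_eq, one_smul]
  calc leftTranslate x n = conv (leftTranslate x w) n := by rw [conv_leftTranslate_left, hwn]
    _ = n := by rw [h, augmentation_leftTranslate, hw.augmentation_eq, one_smul]

end GroupAlgebra

/-! ### Segal algebras -/

section SegalAlgebras

variable {G : Type*} [Group G] [TopologicalSpace G] [IsTopologicalGroup G]
  [LocallyCompactSpace G] [MeasurableSpace G] [BorelSpace G]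
  {μ : Measure G} [μ.IsHaarMeasure] [μ.Regular]
  {S : Type*} [NormedAddCommGroup S] [NormedSpace ℂ S] {ι : S →L[ℂ] LOne μ}

namespace IsSegalAlgebra

theorem mul_apply (h : IsSegalAlgebra ι) (s t : S) : h.mul s t = h.leftAct (ι s) t := rfl

theorem mul_spec (h : IsSegalAlgebra ι) (s t : S) : ι (h.mul s t) = conv (ι s) (ι t) :=
  h.leftAct_spec (ι s) t

theorem leftAct_conv (h : IsSegalAlgebra ι) (f g : LOne μ) (s : S) :
    h.leftAct (conv f g) s = h.leftAct f (h.leftAct g s) :=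
  h.injective (by simp only [leftAct_spec, conv_assoc])

theorem norm_leftAct_le (h : IsSegalAlgebra ι) (f : LOne μ) : ‖h.leftAct f‖ ≤ ‖f‖ :=
  (h.leftAct f).opNorm_le_bound (norm_nonneg f) fun s => (h.left_ideal f s).choose_spec.2

theorem exists_augmentation_eq_one (h : IsSegalAlgebra ι) : ∃ s, augmentation μ (ι s) = 1 := by
  obtain ⟨s, hs⟩ : ∃ s, augmentation μ (ι s) ≠ 0 := by
    by_contra! hzero
    obtain ⟨w, hw⟩ := exists_isBump (μ := μ) (univ_mem (f := 𝓝 (1 : G)))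
    have haug := h.denseRange.equalizer (augmentation μ).continuous continuous_const
      (funext hzero : augmentation μ ∘ ι = fun _ => 0)
    exact one_ne_zero (hw.augmentation_eq.symm.trans (congrFun haug w))
  exact ⟨(augmentation μ (ι s))⁻¹ • s, by simp [hs]⟩

theorem eq_zero_of_forall_conv_eq_zero (h : IsSegalAlgebra ι) {k : LOne μ}
    (hk : ∀ s, conv (ι s) k = 0) : k = 0 :=
  _root_.eq_zero_of_forall_conv_eq_zero fun f =>
    h.denseRange.induction_on f (isClosed_eq (by fun_prop) continuous_const) hk

variable [CompleteSpace S]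

theorem prodMap_tensorLeft (h : IsSegalAlgebra ι) (f : LOne μ) (t : ProjTensor (LOne μ) S) :
    h.prodMap (h.tensorLeft f t) = h.leftAct f (h.prodMap t) := by
  have hcomp : h.prodMap.comp (h.tensorLeft f) = (h.leftAct f).comp h.prodMap :=
    ProjTensor.ext_clm fun g s => by simp [prodMap, tensorLeft, leftAct_conv]
  exact DFunLike.congr_fun hcomp t

theorem prodMap_tensorRight (h : IsSegalAlgebra ι) (s : S) (t : ProjTensor (LOne μ) S) :
    h.prodMap (h.tensorRight s t) = h.mul (h.prodMap t) s := by
  have hcomp : h.prodMap.comp (h.tensorRight s) = (h.mul.flip s).comp h.prodMap :=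
    ProjTensor.ext_clm fun g r => by
      simp [prodMap, tensorRight, mul_apply, leftAct_spec, leftAct_conv]
  exact DFunLike.congr_fun hcomp t

theorem mul_prodMap_comm (h : IsSegalAlgebra ι) {m : ProjTensor (LOne μ) S} {s : S}
    (hm : h.tensorLeft (ι s) m = h.tensorRight s m) :
    h.mul s (h.prodMap m) = h.mul (h.prodMap m) s := by
  rw [mul_apply, ← prodMap_tensorLeft, hm, prodMap_tensorRight]

theorem augmentation_slice (h : IsSegalAlgebra ι) (t : ProjTensor (LOne μ) S) :
    augmentation μ (ProjTensor.slice ((augmentation μ).comp ι) t)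
      = augmentation μ (ι (h.prodMap t)) := by
  have hcomp : (augmentation μ).comp (ProjTensor.slice ((augmentation μ).comp ι))
      = (augmentation μ).comp (ι.comp h.prodMap) := ProjTensor.ext_clm fun g s => by
    simp [prodMap, leftAct_spec, augmentation_conv, mul_comm]
  exact DFunLike.congr_fun hcomp t

/-! ### Compactness of the group -/

omit [CompleteSpace S] in
theorem conv_slice_of_tensorLeft_eq_tensorRight (h : IsSegalAlgebra ι)
    {m : ProjTensor (LOne μ) S} (hm : ∀ s, h.tensorLeft (ι s) m = h.tensorRight s m)
    (f : LOne μ) :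
    conv f (ProjTensor.slice ((augmentation μ).comp ι) m)
      = augmentation μ f • ProjTensor.slice ((augmentation μ).comp ι) m := by
  set ψ := (augmentation μ).comp ι
  have hψ (s : S) : ψ.comp (h.mul.flip s) = augmentation μ (ι s) • ψ := by
    ext t
    simp [ψ, mul_spec, augmentation_conv, mul_comm]
  refine h.denseRange.induction_on f (isClosed_eq (by fun_prop) (by fun_prop)) fun s => ?_
  have hslice := congrArg (ProjTensor.slice ψ) (hm s)
  rw [tensorLeft, tensorRight, ProjTensor.slice_map, ProjTensor.slice_map, hψ,
    ProjTensor.slice_smul] at hslice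
  simpa using hslice

theorem compactSpace_of_hasCentralApproximateDiagonal (h : IsSegalAlgebra ι)
    (hdiag : h.HasCentralApproximateDiagonal) : CompactSpace G := by
  obtain ⟨Γ, _, _, _, m, hm, hlim, -⟩ := hdiag
  obtain ⟨s, hs⟩ := h.exists_augmentation_eq_one
  have haug : Tendsto (fun γ => augmentation μ (ι (h.prodMap (m γ)))) atTop (𝓝 1) := by
    have := ((augmentation μ).comp ι).continuous.continuousAt.tendsto.comp (hlim s)
    simpa [Function.comp_def, mul_spec, augmentation_conv, hs] using this
  obtain ⟨γ, hγ⟩ := (haug.eventually_ne one_ne_zero).exists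
  refine compactSpace_of_forall_conv_eq_smul (fun hzero => hγ ?_)
    (h.conv_slice_of_tensorLeft_eq_tensorRight (hm γ))
  rw [← h.augmentation_slice, hzero, map_zero]

theorem hasCentralApproximateDiagonal_of_isPseudoContractible (h : IsSegalAlgebra ι)
    (hP : IsPseudoContractible h.mul) : h.HasCentralApproximateDiagonal := by
  obtain ⟨Γ, hΓ₁, hΓ₂, hΓ₃, m, hm, hlim⟩ := hP
  set m' := fun γ => ProjTensor.map ι (ContinuousLinearMap.id ℂ S) (m γ)
  have hcentral (γ : Γ) (s : S) : h.tensorLeft (ι s) (m' γ) = h.tensorRight s (m' γ) := by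
    have hι : (conv (ι s)).comp ι = ι.comp (h.mul s) :=
      ContinuousLinearMap.ext fun t => (h.mul_spec s t).symm
    have hmap := congrArg (ProjTensor.map ι (ContinuousLinearMap.id ℂ S)) (hm γ s)
    rw [ProjTensor.map_map, ProjTensor.map_map] at hmap
    rw [tensorLeft, tensorRight, ProjTensor.map_map, ProjTensor.map_map, hι]
    exact hmap
  have hprod (γ : Γ) : h.prodMap (m' γ) = ProjTensor.lift h.mul (m γ) := by
    have hcomp : h.prodMap.comp (ProjTensor.map ι (ContinuousLinearMap.id ℂ S))
        = ProjTensor.lift h.mul := ProjTensor.ext_clm fun s t => by simp [prodMap, mul_apply]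
    exact DFunLike.congr_fun hcomp (m γ)
  have hleft (s : S) : Tendsto (fun γ => h.mul (h.prodMap (m' γ)) s) atTop (𝓝 s) := by
    simpa only [hprod] using hlim s
  refine ⟨Γ, hΓ₁, hΓ₂, hΓ₃, m', hcentral, hleft, fun s => ?_⟩
  simpa only [h.mul_prodMap_comm (hcentral _ s)] using hleft s

end IsSegalAlgebra

namespace IsSymmetricSegalAlgebra

theorem compactSpace_of_isProjectiveBimodule [CompleteSpace S] (h : IsSymmetricSegalAlgebra ι)
    (hproj : h.IsProjectiveBimodule) : CompactSpace G := by
  obtain ⟨ρ, hleft, hright, hsplit⟩ := hproj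
  set ψ := (augmentation μ).comp ι
  have hψ (f : LOne μ) : ψ.comp (h.rightAct f) = augmentation μ f • ψ := by
    ext s
    simp [ψ, rightAct_spec, augmentation_conv, mul_comm]
  set σ : S → LOne μ := fun s => ProjTensor.slice ψ (ρ s)
  have hσ_left (f : LOne μ) (s : S) : σ (h.leftAct f s) = conv f (σ s) := by
    simp [σ, hleft, IsSegalAlgebra.tensorLeft, ProjTensor.slice_map]
  have hσ_right (f : LOne μ) (s : S) : σ (h.rightAct f s) = augmentation μ f • σ s := by
    simp [σ, hright, ProjTensor.slice_map, hψ, ProjTensor.slice_smul]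
  obtain ⟨t, ht⟩ := h.exists_augmentation_eq_one
  have hσ_eq (s : S) : σ s = conv (ι s) (σ t) := by
    have hst : h.rightAct (ι t) s = h.leftAct (ι s) t :=
      h.injective (by rw [rightAct_spec, IsSegalAlgebra.leftAct_spec])
    rw [← hσ_left, ← hst, hσ_right, ht, one_smul]
  refine compactSpace_of_forall_conv_eq_smul (n := σ t) (fun hzero => ?_) fun f => ?_
  · have haug := h.augmentation_slice (ρ t)
    rw [hsplit, ht] at haug
    exact one_ne_zero (haug.symm.trans ((congrArg _ hzero).trans (map_zero _)))
  · refine sub_eq_zero.1 (h.toIsSegalAlgebra.eq_zero_of_forall_conv_eq_zero fun s => ?_)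
    rw [map_sub, map_smul, ← conv_assoc, ← rightAct_spec h f s, ← hσ_eq, ← hσ_eq, hσ_right,
      sub_self]

end IsSymmetricSegalAlgebra
end SegalAlgebras

section SegalTranslation

variable {G : Type*} [Group G] [TopologicalSpace G] [IsTopologicalGroup G]
  [LocallyCompactSpace G] [MeasurableSpace G] [BorelSpace G]
  {μ : Measure G} [μ.IsHaarMeasure] [μ.Regular]
  {S : Type*} [NormedAddCommGroup S] [NormedSpace ℂ S] [CompleteSpace S] {ι : S →L[ℂ] LOne μ}

namespace IsSegalAlgebra

theorem tendsto_leftAct_bumps (h : IsSegalAlgebra ι) (s : S) :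
    Tendsto (fun w => h.leftAct w s) (bumps μ) (𝓝 s) := by
  have hbound : ∀ᶠ w in bumps μ, ‖h.leftAct w‖ ≤ 1 :=
    eventually_bumps_norm_le_one.mono fun w hw => (h.norm_leftAct_le w).trans hw
  refine tendsto_apply_of_dense hbound h.essential (L := ContinuousLinearMap.id ℂ S)
    (fun t ht => ?_) s
  induction ht using Submodule.span_induction with
  | mem t ht =>
    obtain ⟨f, r, ht⟩ := ht
    obtain rfl : t = h.leftAct f r := h.injective (ht.trans (h.leftAct_spec f r).symm)
    refine (((h.leftAct.flip r).continuous.tendsto f).comp (tendsto_conv_bumps f)).congr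
      fun w => ?_
    exact h.leftAct_conv w f r
  | zero => simp
  | add t r _ _ ht hr => simpa only [map_add] using ht.add hr
  | smul c t _ ht => simpa only [map_smul] using ht.const_smul c

/-- Left translation on a Segal algebra, transported along the injection into `L¹(G)`. -/
noncomputable def translateLinear (h : IsSegalAlgebra ι) (x : G) : S →ₗ[ℂ] S :=
  (LinearEquiv.ofInjective (ι : S →ₗ[ℂ] LOne μ) h.injective).symm ∘ₗ
    ((leftTranslateL x).comp ι : S →ₗ[ℂ] LOne μ).codRestrict (LinearMap.range (ι : S →ₗ[ℂ] LOne μ))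
      (h.translation x)

omit [CompleteSpace S] in
theorem translateLinear_spec (h : IsSegalAlgebra ι) (x : G) (s : S) :
    ι (h.translateLinear x s) = leftTranslate x (ι s) :=
  congrArg Subtype.val
    ((LinearEquiv.ofInjective (ι : S →ₗ[ℂ] LOne μ) h.injective).apply_symm_apply _)

/-- Left translation on a Segal algebra as a bounded operator; the boundedness comes from the
closed graph theorem. -/
noncomputable def translate (h : IsSegalAlgebra ι) (x : G) : S →L[ℂ] S :=
  ContinuousLinearMap.ofSeqClosedGraph (g := h.translateLinear x) fun u s t hu hv => by
    refine h.injective ((tendsto_nhds_unique ((ι.continuous.tendsto t).comp hv) ?_).trans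
      (h.translateLinear_spec x s).symm)
    exact ((((leftTranslateL x).comp ι).continuous.tendsto s).comp hu).congr
      fun n => (h.translateLinear_spec x (u n)).symm

theorem translate_spec (h : IsSegalAlgebra ι) (x : G) (s : S) :
    ι (h.translate x s) = leftTranslate x (ι s) :=
  h.translateLinear_spec x s

theorem translate_mul (h : IsSegalAlgebra ι) (x y : G) (s : S) :
    h.translate (x * y) s = h.translate x (h.translate y s) :=
  h.injective (by simp only [translate_spec, leftTranslate_mul])

theorem translate_leftAct (h : IsSegalAlgebra ι) (x : G) (f : LOne μ) (s : S) :
    h.translate x (h.leftAct f s) = h.leftAct (leftTranslate x f) s :=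
  h.injective (by simp only [translate_spec, leftAct_spec, conv_leftTranslate_left])

theorem norm_translate_le (h : IsSegalAlgebra ι) (x : G) (s : S) : ‖h.translate x s‖ ≤ ‖s‖ := by
  have hlim := ((h.translate x).continuous.tendsto s).comp (h.tendsto_leftAct_bumps s)
  refine le_of_tendsto hlim.norm (eventually_bumps_norm_le_one.mono fun w hw => ?_)
  rw [Function.comp_apply, translate_leftAct]
  refine ((h.leftAct _).le_of_opNorm_le ((h.norm_leftAct_le _).trans ?_) s).trans_eq (one_mul _)
  rwa [norm_leftTranslate]

theorem continuous_translate (h : IsSegalAlgebra ι) (s : S) :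
    Continuous fun x => h.translate x s := by
  refine continuous_of_uniform_approx_of_continuous fun u hu => ?_
  obtain ⟨ε, hε, hεu⟩ := Metric.mem_uniformity_dist.1 hu
  obtain ⟨w, hw⟩ := ((h.tendsto_leftAct_bumps s).eventually (Metric.ball_mem_nhds s hε)).exists
  refine ⟨fun x => h.translate x (h.leftAct w s), ?_, fun x => hεu ?_⟩
  · simp only [translate_leftAct]
    exact (h.leftAct.flip s).continuous.comp (continuous_leftTranslate w)
  · rw [dist_comm, dist_eq_norm, ← map_sub]
    exact (h.norm_translate_le x _).trans_lt (mem_ball_iff_norm.1 hw)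

theorem integrable_smul_translate (h : IsSegalAlgebra ι) (f : LOne μ) (s : S) :
    Integrable (fun y => f y • h.translate y s) μ := by
  refine Integrable.mono' ((L1.integrable_coeFn f).norm.mul_const ‖s‖)
    (aestronglyMeasurable_smul_continuous (L1.integrable_coeFn f) (h.continuous_translate s))
    (Eventually.of_forall fun y => ?_)
  rw [norm_smul]
  exact mul_le_mul_of_nonneg_left (h.norm_translate_le y s) (norm_nonneg _)

theorem leftAct_eq_integral (h : IsSegalAlgebra ι) (f : LOne μ) (s : S) :
    h.leftAct f s = ∫ y, f y • h.translate y s ∂μ := by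
  refine h.injective ?_
  rw [leftAct_spec, conv_apply, ← ι.integral_comp_comm (h.integrable_smul_translate f s)]
  simp only [map_smul, translate_spec]

end IsSegalAlgebra
end SegalTranslation

/-! ### Compact groups -/

section CompactGroup

variable {G : Type*} [Group G] [TopologicalSpace G] [IsTopologicalGroup G]

/-- The orbit map `y ↦ L_y w` of a continuous function. -/
noncomputable def leftOrbit (w : C(G, ℂ)) : C(G, C(G, ℂ)) :=
  ContinuousMap.curry ⟨fun p : G × G => w (p.1⁻¹ * p.2), by fun_prop⟩

@[simp] theorem leftOrbit_apply (w : C(G, ℂ)) (y x : G) : leftOrbit w y x = w (y⁻¹ * x) := rfl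

variable [CompactSpace G] [MeasurableSpace G] [BorelSpace G] {μ : Measure G} [μ.IsHaarMeasure]

theorem eq_of_isMulLeftInvariant_of_measure_univ_eq {ν : Measure G} [ν.IsMulLeftInvariant]
    [IsFiniteMeasureOnCompacts ν] (huniv : ν Set.univ = μ Set.univ) : ν = μ := by
  have hν : ν = Measure.haarScalarFactor ν μ • μ :=
    Measure.isMulInvariant_eq_smul_of_compactSpace ν μ
  have hc : (Measure.haarScalarFactor ν μ : ℝ≥0∞) * μ Set.univ = μ Set.univ := by
    rw [← huniv]
    conv_rhs => rw [hν]
    rw [Measure.smul_apply, ENNReal.smul_def, smul_eq_mul, huniv]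
  rw [ENNReal.mul_eq_right (Measure.measure_univ_ne_zero.2 (NeZero.ne μ))
    (measure_ne_top μ _)] at hc
  rw [hν, show Measure.haarScalarFactor ν μ = 1 by exact_mod_cast hc, one_smul]

instance isMulRightInvariant_of_compactSpace : μ.IsMulRightInvariant :=
  ⟨fun g => eq_of_isMulLeftInvariant_of_measure_univ_eq <| by
    rw [Measure.map_apply (measurable_mul_const g) MeasurableSet.univ, Set.preimage_univ]⟩

instance isInvInvariant_of_compactSpace : μ.IsInvInvariant := by
  have : IsFiniteMeasureOnCompacts μ.inv := ⟨fun K hK => by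
    rw [Measure.inv_apply]
    exact hK.inv.measure_lt_top⟩
  refine ⟨eq_of_isMulLeftInvariant_of_measure_univ_eq ?_⟩
  rw [Measure.inv_apply, Set.inv_univ]

section IntegralAgainst

variable {X Y : Type*} [NormedAddCommGroup X] [NormedSpace ℂ X] [NormedAddCommGroup Y]
  [NormedSpace ℂ Y]

theorem integrable_smul_continuousMap (f : LOne μ) (Φ : C(G, X)) :
    Integrable (fun y => f y • Φ y) μ := by
  refine Integrable.mono' ((L1.integrable_coeFn f).norm.mul_const ‖Φ‖)
    (aestronglyMeasurable_smul_continuous (L1.integrable_coeFn f) Φ.continuous)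
    (Eventually.of_forall fun y => ?_)
  rw [norm_smul]
  exact mul_le_mul_of_nonneg_left (Φ.norm_coe_le_norm y) (norm_nonneg _)

/-- The bounded operator `f ↦ ∫ f(y) Φ(y) dy` on `L¹(G)` given by a continuous vector-valued
function `Φ`. -/
noncomputable def integralAgainst (Φ : C(G, X)) : LOne μ →L[ℂ] X :=
  LinearMap.mkContinuous
    { toFun := fun f => ∫ y, f y • Φ y ∂μ
      map_add' := fun f g => by
        rw [← integral_add (integrable_smul_continuousMap f Φ) (integrable_smul_continuousMap g Φ)]
        refine integral_congr_ae ?_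
        filter_upwards [Lp.coeFn_add f g] with y hy
        rw [hy, Pi.add_apply, add_smul]
      map_smul' := fun c f => by
        rw [RingHom.id_apply, ← integral_smul]
        refine integral_congr_ae ?_
        filter_upwards [Lp.coeFn_smul c f] with y hy
        rw [hy, Pi.smul_apply, smul_assoc] }
    ‖Φ‖ fun f => by
      rw [L1.norm_eq_integral_norm, mul_comm, ← integral_mul_const]
      refine norm_integral_le_of_norm_le ((L1.integrable_coeFn f).norm.mul_const _)
        (Eventually.of_forall fun y => ?_)
      rw [norm_smul]
      exact mul_le_mul_of_nonneg_left (Φ.norm_coe_le_norm y) (norm_nonneg _)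

theorem integralAgainst_apply (Φ : C(G, X)) (f : LOne μ) :
    integralAgainst Φ f = ∫ y, f y • Φ y ∂μ := rfl

theorem norm_integralAgainst_apply_le (Φ : C(G, X)) (f : LOne μ) :
    ‖integralAgainst Φ f‖ ≤ ‖Φ‖ * ‖f‖ :=
  (integralAgainst Φ).le_of_opNorm_le (LinearMap.mkContinuous_norm_le _ (norm_nonneg _) _) f

theorem integralAgainst_sub_apply (Φ Ψ : C(G, X)) (f : LOne μ) :
    integralAgainst (Φ - Ψ) f = integralAgainst Φ f - integralAgainst Ψ f := by
  simp only [integralAgainst_apply, ContinuousMap.sub_apply, smul_sub]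
  exact integral_sub (integrable_smul_continuousMap f Φ) (integrable_smul_continuousMap f Ψ)

variable [CompleteSpace X] [CompleteSpace Y]

theorem map_integralAgainst (T : X →L[ℂ] Y) (Φ : C(G, X)) (f : LOne μ) :
    T (integralAgainst Φ f) = ∫ y, f y • T (Φ y) ∂μ := by
  rw [integralAgainst_apply, ← T.integral_comp_comm (integrable_smul_continuousMap f Φ)]
  simp only [map_smul]

end IntegralAgainst

section ContinuousFunctions

variable (μ) in
/-- The inclusion of the continuous functions on a compact group into `L¹(G)`. -/
noncomputable abbrev toLOne : C(G, ℂ) →L[ℂ] LOne μ := ContinuousMap.toLp 1 μ ℂ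

omit [IsTopologicalGroup G] in
theorem toLOne_ae_eq (w : C(G, ℂ)) : toLOne μ w =ᵐ[μ] w := ContinuousMap.coeFn_toLp μ w

theorem toLOne_leftOrbit (w : C(G, ℂ)) (y : G) :
    toLOne μ (leftOrbit w y) = leftTranslate y (toLOne μ w) := by
  refine Lp.ext ?_
  filter_upwards [toLOne_ae_eq (μ := μ) (leftOrbit w y), leftTranslate_ae_eq y (toLOne μ w),
    (measurePreserving_mul_left μ y⁻¹).quasiMeasurePreserving.ae (toLOne_ae_eq (μ := μ) w)]
    with x horbit htranslate hw
  rw [horbit, htranslate, hw, leftOrbit_apply]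

/-- Convolution on the right by a continuous function `w`, as a bounded operator
`f ↦ f * w` from `L¹(G)` to `C(G)`. -/
noncomputable def convContinuous (w : C(G, ℂ)) : LOne μ →L[ℂ] C(G, ℂ) :=
  integralAgainst (leftOrbit w)

theorem convContinuous_apply (w : C(G, ℂ)) (f : LOne μ) (x : G) :
    convContinuous w f x = ∫ y, f y * w (y⁻¹ * x) ∂μ :=
  map_integralAgainst (ContinuousMap.evalCLM ℂ x) (leftOrbit w) f

theorem toLOne_convContinuous (w : C(G, ℂ)) (f : LOne μ) :
    toLOne μ (convContinuous w f) = conv f (toLOne μ w) := by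
  rw [convContinuous, map_integralAgainst, conv_apply]
  simp only [toLOne_leftOrbit]
  rfl

theorem convContinuous_toLOne_apply (w f : C(G, ℂ)) (x : G) :
    convContinuous w (toLOne μ f) x = ∫ y, f y * w (y⁻¹ * x) ∂μ := by
  rw [convContinuous_apply]
  refine integral_congr_ae ?_
  filter_upwards [toLOne_ae_eq (μ := μ) f] with y hy
  rw [hy]

end ContinuousFunctions
end CompactGroup

section Center

variable {G : Type*} [Group G] [TopologicalSpace G] [IsTopologicalGroup G]
  [LocallyCompactSpace G] [MeasurableSpace G] [BorelSpace G] {μ : Measure G} [μ.IsHaarMeasure]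
  [μ.Regular]

variable (μ) in
/-- The center of the convolution algebra `L¹(G)`. -/
noncomputable def convCenter : Submodule ℂ (LOne μ) := (conv (μ := μ) - conv.flip).ker

theorem mem_convCenter {u : LOne μ} : u ∈ convCenter μ ↔ ∀ f, conv u f = conv f u := by
  simp [convCenter, LinearMap.mem_ker, ContinuousLinearMap.ext_iff, sub_eq_zero]

theorem isClosed_convCenter : IsClosed (convCenter μ : Set (LOne μ)) :=
  ContinuousLinearMap.isClosed_ker _

theorem conv_mem_convCenter {u v : LOne μ} (hu : u ∈ convCenter μ) (hv : v ∈ convCenter μ) :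
    conv u v ∈ convCenter μ := mem_convCenter.2 fun f => by
  rw [mem_convCenter] at hu hv
  rw [conv_assoc, hv, ← conv_assoc, hu, conv_assoc]

end Center

section ClassFunctions

variable {G : Type*} [Group G] [TopologicalSpace G]

/-- A continuous function on a group that is constant on conjugacy classes. -/
def IsClassFunction (w : C(G, ℂ)) : Prop := ∀ x y, w (x * y) = w (y * x)

variable [IsTopologicalGroup G] [CompactSpace G]
  [MeasurableSpace G] [BorelSpace G] {μ : Measure G} [μ.IsHaarMeasure]

theorem IsClassFunction.convContinuous_toLOne_comm {w : C(G, ℂ)} (hw : IsClassFunction w)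
    (f : C(G, ℂ)) : convContinuous f (toLOne μ w) = convContinuous w (toLOne μ f) := by
  ext x
  rw [convContinuous_toLOne_apply, convContinuous_toLOne_apply,
    ← integral_div_left_eq_self (fun y => w y * f (y⁻¹ * x)) μ x]
  refine integral_congr_ae (Eventually.of_forall fun y => ?_)
  simp only [div_eq_mul_inv, mul_inv_rev, inv_inv, inv_mul_cancel_right]
  rw [hw x y⁻¹, mul_comm]

theorem IsClassFunction.toLOne_mem_convCenter [T2Space G] {w : C(G, ℂ)} (hw : IsClassFunction w) :
    toLOne μ w ∈ convCenter μ := mem_convCenter.2 fun f => by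
  refine (ContinuousMap.toLp_denseRange ℂ μ ℂ ENNReal.one_ne_top).induction_on
    (p := fun f : LOne μ => conv (toLOne μ w) f = conv f (toLOne μ w)) f
    (isClosed_eq (by fun_prop) (by fun_prop)) fun v => ?_
  rw [← toLOne_convContinuous, ← toLOne_convContinuous, hw.convContinuous_toLOne_comm]

end ClassFunctions

section CentralBumps

variable {G : Type*} [Group G] [TopologicalSpace G] [IsTopologicalGroup G] [CompactSpace G]

theorem exists_conj_invariant_nhds {V : Set G} (hV : V ∈ 𝓝 (1 : G)) :
    ∃ U : Set G, IsOpen U ∧ 1 ∈ U ∧ ∀ u ∈ U, ∀ y : G, y * u * y⁻¹ ∈ V := by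
  have hconj : ∀ᶠ u in 𝓝 (1 : G), ∀ y ∈ (Set.univ : Set G), y * u * y⁻¹ ∈ V := by
    refine isCompact_univ.eventually_forall_of_forall_eventually fun y _ => ?_
    have hcont : Continuous fun p : G × G => p.2 * p.1 * p.2⁻¹ := by fun_prop
    exact hcont.continuousAt.eventually_mem (by simpa using hV)
  obtain ⟨U, hU, hUo, hU1⟩ := mem_nhds_iff.1 hconj
  exact ⟨U, hUo, hU1, fun u hu y => hU hu y (Set.mem_univ y)⟩

theorem exists_symmetric_bump [T2Space G] {V : Set G} (hV : V ∈ 𝓝 (1 : G)) :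
    ∃ k : C(G, ℝ), k 1 ≠ 0 ∧ (∀ x, 0 ≤ k x) ∧ (∀ x, k x⁻¹ = k x) ∧
      ∀ x ∉ V, ∀ y, k (y * x * y⁻¹) = 0 := by
  obtain ⟨U, hUo, hU1, hU⟩ := exists_conj_invariant_nhds hV
  obtain ⟨g, hg0, hg1, hg⟩ := exists_continuous_zero_one_of_isClosed hUo.isClosed_compl
    (isClosed_singleton (x := (1 : G))) (Set.disjoint_singleton_right.2 fun h => h hU1)
  have hg1' : g 1 = 1 := hg1 rfl
  refine ⟨g * g.comp ⟨fun x => x⁻¹, continuous_inv⟩, by simp [hg1'],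
    fun x => mul_nonneg (hg x).1 (hg x⁻¹).1, fun x => by simp [mul_comm], fun x hx y => ?_⟩
  have hxU : g (y * x * y⁻¹) = 0 := hg0 fun h => hx (by simpa [mul_assoc] using hU _ h y⁻¹)
  simp [hxU]

variable [MeasurableSpace G] [BorelSpace G] {μ : Measure G} [μ.IsHaarMeasure]

variable (μ) in
/-- The class function `x ↦ ∫ k(y x y⁻¹) dy` obtained by averaging `k` over conjugations. -/
noncomputable def conjAverage (k : C(G, ℝ)) : C(G, ℝ) :=
  ∫ y, ContinuousMap.curry ⟨fun p : G × G => k (p.1 * p.2 * p.1⁻¹), by fun_prop⟩ y ∂μ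

theorem conjAverage_apply (k : C(G, ℝ)) (x : G) :
    conjAverage μ k x = ∫ y, k (y * x * y⁻¹) ∂μ := by
  let Ψ : C(G, C(G, ℝ)) :=
    ContinuousMap.curry ⟨fun p : G × G => k (p.1 * p.2 * p.1⁻¹), by fun_prop⟩
  exact ((ContinuousMap.evalCLM ℝ x).integral_comp_comm (μ := μ)
    (Ψ.continuous.integrable_of_hasCompactSupport (HasCompactSupport.of_compactSpace Ψ))).symm

theorem conjAverage_mul_comm (k : C(G, ℝ)) (x y : G) :
    conjAverage μ k (x * y) = conjAverage μ k (y * x) := by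
  rw [conjAverage_apply, conjAverage_apply,
    ← integral_mul_right_eq_self (fun z => k (z * (y * x) * z⁻¹)) x]
  simp only [mul_inv_rev, mul_assoc, mul_inv_cancel_left]

theorem conjAverage_inv {k : C(G, ℝ)} (hk : ∀ x, k x⁻¹ = k x) (x : G) :
    conjAverage μ k x⁻¹ = conjAverage μ k x := by
  have hinv (y : G) : k (y * x⁻¹ * y⁻¹) = k (y * x * y⁻¹) := by
    rw [← conj_inv, hk]
  simp only [conjAverage_apply, hinv]

omit [IsTopologicalGroup G] in
theorem isBump_toLOne_ofReal {V : Set G} {r : C(G, ℝ)} (hr : ∀ x, 0 ≤ r x)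
    (hint : ∫ x, r x ∂μ = 1) (hV : ∀ x ∉ V, r x = 0) :
    IsBump V (toLOne μ ((⟨_, Complex.continuous_ofReal⟩ : C(ℝ, ℂ)).comp r)) := by
  set w : C(G, ℂ) := (⟨_, Complex.continuous_ofReal⟩ : C(ℝ, ℂ)).comp r
  refine ⟨?_, ?_, ?_⟩
  · filter_upwards [toLOne_ae_eq (μ := μ) w] with x hx hxV
    rw [hx]
    simp [w, hV x hxV]
  · rw [augmentation_apply, integral_congr_ae (toLOne_ae_eq w), ← Complex.ofReal_one, ← hint]
    exact integral_complex_ofReal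
  · rw [L1.norm_eq_integral_norm, ← hint]
    refine (integral_congr_ae ?_).le
    filter_upwards [toLOne_ae_eq (μ := μ) w] with x hx
    rw [hx]
    simp [w, abs_of_nonneg (hr x)]

variable (μ) in
/-- The continuous functions `w` on `G`, viewed in `L¹(G)`, that are constant on conjugacy classes
and satisfy `w(x⁻¹) = conj (w x)`; convolution by such a `w` is self-adjoint on `L²(G)`. -/
def hermitianClassFunctions : Set (LOne μ) :=
  {u | ∃ w : C(G, ℂ), IsClassFunction w ∧ (∀ x, starRingEnd ℂ (w x⁻¹) = w x) ∧ u = toLOne μ w}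

variable [T2Space G]

theorem exists_mem_hermitianClassFunctions_isBump {V : Set G} (hV : V ∈ 𝓝 (1 : G)) :
    ∃ u ∈ hermitianClassFunctions μ, IsBump V u := by
  obtain ⟨k, hk1, hk0, hkinv, hkV⟩ := exists_symmetric_bump hV
  set r := conjAverage μ k with hr
  have hr0 (x : G) : 0 ≤ r x := by
    rw [hr, conjAverage_apply]
    exact integral_nonneg fun y => hk0 _
  have hrV (x : G) (hx : x ∉ V) : r x = 0 := by simp [hr, conjAverage_apply, hkV x hx]
  have hr1 : r 1 ≠ 0 := by
    simpa [hr, conjAverage_apply] using ⟨measureReal_univ_pos.ne', hk1⟩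
  have hpos : 0 < ∫ x, r x ∂μ := r.continuous.integral_pos_of_hasCompactSupport_nonneg_nonzero
    (HasCompactSupport.of_compactSpace _) hr0 hr1
  refine ⟨_, ⟨_, fun x y => ?_, fun x => ?_, rfl⟩,
    isBump_toLOne_ofReal (r := (∫ x, r x ∂μ)⁻¹ • r)
      (fun x => mul_nonneg (inv_nonneg.2 hpos.le) (hr0 x)) ?_ fun x hx => by simp [hrV x hx]⟩
  · simp [hr, conjAverage_mul_comm k x y]
  · simp [hr, conjAverage_inv hkinv x]
  · simp [integral_const_mul, hpos.ne']

variable (μ) in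
/-- The filter of hermitian central continuous bumps on a compact group whose supports shrink to
the identity. -/
def centralBumps : Filter (LOne μ) := bumps μ ⊓ 𝓟 (hermitianClassFunctions μ)

instance centralBumps_neBot : (centralBumps μ).NeBot :=
  inf_principal_bumps_neBot fun _ hV => exists_mem_hermitianClassFunctions_isBump hV

omit [IsTopologicalGroup G] [T2Space G] in
theorem eventually_centralBumps_mem_hermitianClassFunctions :
    ∀ᶠ u in centralBumps μ, u ∈ hermitianClassFunctions μ :=
  mem_inf_of_right (mem_principal_self _)

omit [IsTopologicalGroup G] [T2Space G] in
theorem eventually_centralBumps_norm_le_one : ∀ᶠ w in centralBumps μ, ‖w‖ ≤ 1 :=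
  eventually_bumps_norm_le_one.filter_mono inf_le_left

theorem eventually_centralBumps_mem_convCenter : ∀ᶠ u in centralBumps μ, u ∈ convCenter μ :=
  eventually_centralBumps_mem_hermitianClassFunctions.mono
    fun _ ⟨_, hw, _, hu⟩ => hu ▸ hw.toLOne_mem_convCenter

end CentralBumps

/-! ### Spectral theory of convolution operators -/

section Spectral

theorem finiteDimensional_eigenspace_of_isCompactOperator {E : Type*} [NormedAddCommGroup E]
    [NormedSpace ℂ E] {T : E →L[ℂ] E} (hT : IsCompactOperator T) {c : ℂ} (hc : c ≠ 0) :
    FiniteDimensional ℂ (Module.End.eigenspace T.toLinearMap c) := by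
  have hrestrict := hT.restrict ((Module.End.mem_invtSubmodule_iff_forall_mem_of_mem _).1
    (Module.End.eigenspace_mem_invtSubmodule T.toLinearMap c)) (T.isClosed_eigenspace c)
  rw [Module.End.restrict_eigenspace, LinearMap.coe_smul,
    IsCompactOperator.smul_iff₀ hc] at hrestrict
  rwa [← isCompactOperator_id_iff_finiteDimensional]

theorem map_apply_mem_of_forall_eigenvector {H X : Type*} [NormedAddCommGroup H]
    [InnerProductSpace ℂ H] [CompleteSpace H] [NormedAddCommGroup X] [NormedSpace ℂ X]
    {T : H →L[ℂ] H} (hT : IsCompactOperator T) (hsymm : T.IsSymmetric) (Q : H →L[ℂ] X)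
    {P : Submodule ℂ X} (hP : IsClosed (P : Set X))
    (heigen : ∀ c : ℂ, c ≠ 0 → ∀ g, T g = c • g → Q g ∈ P) (g : H) : Q (T g) ∈ P := by
  have hdense : (⨆ c, Module.End.eigenspace T.toLinearMap c).topologicalClosure = ⊤ :=
    Submodule.topologicalClosure_eq_top_iff.2
      (ContinuousLinearMap.orthogonalComplement_iSup_eigenspaces_eq_bot hT hsymm)
  have hspan : (⨆ c, Module.End.eigenspace T.toLinearMap c) ≤ P.comap (Q.comp T).toLinearMap := by
    refine iSup_le fun c g hg => ?_
    have hTg : T g = c • g := Module.End.mem_eigenspace_iff.1 hg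
    change Q (T g) ∈ P
    rw [hTg, map_smul]
    rcases eq_or_ne c 0 with rfl | hc
    · simp
    · exact P.smul_mem c (heigen c hc g hTg)
  exact Submodule.topologicalClosure_minimal _ hspan (hP.preimage (Q.comp T).continuous)
    (hdense ▸ Submodule.mem_top)

variable {G : Type*} [Group G] [TopologicalSpace G] [IsTopologicalGroup G] [CompactSpace G]
  [MeasurableSpace G] [BorelSpace G] {μ : Measure G} [μ.IsHaarMeasure]

theorem isCompactOperator_integralAgainst {K : Type*} [TopologicalSpace K] [CompactSpace K]
    [LocallyCompactSpace K] (Φ : C(G, C(K, ℂ))) :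
    IsCompactOperator (integralAgainst (μ := μ) Φ) := by
  let Ψ : C(K, C(G, ℂ)) := ContinuousMap.curry ⟨fun p : K × G => Φ p.2 p.1,
    (ContinuousMap.continuous_uncurry_of_continuous Φ).comp continuous_swap⟩
  have happly (f : LOne μ) (x : K) : integralAgainst Φ f x = integralAgainst (Ψ x) f :=
    map_integralAgainst (ContinuousMap.evalCLM ℂ x) Φ f
  let e := ContinuousMap.linearIsometryBoundedOfCompact K ℂ ℂ
  set A := (fun f => e (integralAgainst (μ := μ) Φ f)) '' Metric.closedBall 0 1
  have hA : IsCompact (closure A) := by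
    refine BoundedContinuousFunction.arzela_ascoli (Metric.closedBall (0 : ℂ) ‖Φ‖)
      (isCompact_closedBall _ _) A ?_ ?_
    · rintro _ x ⟨f, hf, rfl⟩
      rw [mem_closedBall_zero_iff] at hf ⊢
      exact ((integralAgainst Φ f).norm_coe_le_norm x).trans
        ((norm_integralAgainst_apply_le Φ f).trans (mul_le_of_le_one_right (norm_nonneg _) hf))
    · intro x
      refine Metric.equicontinuousAt_iff_right.2 fun ε hε => ?_
      filter_upwards [Metric.tendsto_nhds.1 (Ψ.continuous.tendsto x) ε hε]
      rintro x' hx' ⟨_, f, hf, rfl⟩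
      rw [mem_closedBall_zero_iff] at hf
      rw [dist_eq_norm] at hx'
      rw [dist_comm, dist_eq_norm]
      change ‖integralAgainst Φ f x' - integralAgainst Φ f x‖ < ε
      rw [happly, happly, ← integralAgainst_sub_apply]
      exact ((norm_integralAgainst_apply_le _ f).trans
        (mul_le_of_le_one_right (norm_nonneg _) hf)).trans_lt hx'
  refine (isCompactOperator_iff_image_closedBall_subset_compact
    (integralAgainst (μ := μ) Φ).toLinearMap one_pos).2
    ⟨e.symm '' closure A, hA.image e.symm.continuous, ?_⟩
  rintro _ ⟨f, hf, rfl⟩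
  exact ⟨_, subset_closure ⟨f, hf, rfl⟩, e.symm_apply_apply _⟩

theorem isCompactOperator_conv_flip_toLOne (w : C(G, ℂ)) :
    IsCompactOperator ((conv (μ := μ)).flip (toLOne μ w)) := by
  have hconv : (conv (μ := μ)).flip (toLOne μ w) = (toLOne μ).comp (convContinuous w) :=
    ContinuousLinearMap.ext fun f => (toLOne_convContinuous w f).symm
  rw [hconv]
  exact (isCompactOperator_integralAgainst (leftOrbit w)).clm_comp (toLOne μ)

theorem IsSegalAlgebra.mem_range_of_conv_eq_smul {S : Type*} [NormedAddCommGroup S]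
    [NormedSpace ℂ S] {ι : S →L[ℂ] LOne μ} (h : IsSegalAlgebra ι) {w : C(G, ℂ)}
    (hw : toLOne μ w ∈ convCenter μ) {c : ℂ} (hc : c ≠ 0) {f : LOne μ}
    (hf : conv f (toLOne μ w) = c • f) : f ∈ ι.range := by
  set D := Module.End.eigenspace ((conv (μ := μ)).flip (toLOne μ w)).toLinearMap c
  have : FiniteDimensional ℂ D :=
    finiteDimensional_eigenspace_of_isCompactOperator (isCompactOperator_conv_flip_toLOne w) hc
  have hclosed : IsClosed ((D ⊓ ι.range : Submodule ℂ (LOne μ)) : Set (LOne μ)) :=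
    Submodule.closed_of_finiteDimensional _
  have hconv (g : LOne μ) : conv f g ∈ D ⊓ ι.range := by
    refine h.denseRange.induction_on (p := fun g => conv f g ∈ D ⊓ ι.range) g
      (hclosed.preimage (conv f).continuous) fun s =>
        ⟨Module.End.mem_eigenspace_iff.2 ?_, h.leftAct f s, h.leftAct_spec f s⟩
    change conv (conv f (ι s)) (toLOne μ w) = c • conv f (ι s)
    rw [conv_assoc, ← mem_convCenter.1 hw, ← conv_assoc, hf, map_smul]
    rfl
  have hcf := (hconv (toLOne μ w)).2
  rw [hf] at hcf
  exact (Submodule.smul_mem_iff _ hc).1 hcf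

section LTwo

variable (μ) in
/-- The inclusion of the continuous functions on a compact group into `L²(G)`. -/
noncomputable abbrev toLTwo : C(G, ℂ) →L[ℂ] Lp ℂ 2 μ := ContinuousMap.toLp 2 μ ℂ

omit [IsTopologicalGroup G] in
theorem toLTwo_ae_eq (w : C(G, ℂ)) : toLTwo μ w =ᵐ[μ] w := ContinuousMap.coeFn_toLp μ w

/-- The inclusion of `L²(G)` into `L¹(G)` for a compact group. -/
noncomputable def lTwoInclusion : Lp ℂ 2 μ →L[ℂ] LOne μ :=
  LinearMap.mkContinuous
    { toFun := fun g => ((Lp.memLp g).mono_exponent one_le_two).toLp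
      map_add' := fun f g => by
        rw [← MemLp.toLp_add]
        exact MemLp.toLp_congr _ _ (Lp.coeFn_add f g)
      map_smul' := fun c f => by
        rw [RingHom.id_apply, ← MemLp.toLp_const_smul]
        exact MemLp.toLp_congr _ _ (Lp.coeFn_smul c f) }
    ((μ Set.univ) ^ (1 / (1 : ℝ≥0∞).toReal - 1 / (2 : ℝ≥0∞).toReal)).toReal fun g => by
      change ‖((Lp.memLp g).mono_exponent one_le_two).toLp‖ ≤ _
      rw [Lp.norm_toLp, Lp.norm_def, ← ENNReal.toReal_mul, mul_comm]
      refine ENNReal.toReal_mono ?_ (eLpNorm_le_eLpNorm_mul_rpow_measure_univ one_le_two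
        (Lp.aestronglyMeasurable g))
      refine ENNReal.mul_ne_top (Lp.eLpNorm_ne_top g) ?_
      exact ENNReal.rpow_ne_top_of_nonneg (by norm_num) (measure_ne_top μ _)

omit [IsTopologicalGroup G] [BorelSpace G] in
theorem lTwoInclusion_ae_eq (g : Lp ℂ 2 μ) : lTwoInclusion g =ᵐ[μ] g :=
  MemLp.coeFn_toLp ((Lp.memLp g).mono_exponent one_le_two)

omit [IsTopologicalGroup G] in
theorem lTwoInclusion_toLTwo (w : C(G, ℂ)) : lTwoInclusion (toLTwo μ w) = toLOne μ w := by
  refine Lp.ext ?_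
  filter_upwards [lTwoInclusion_ae_eq (toLTwo μ w), toLTwo_ae_eq (μ := μ) w,
    toLOne_ae_eq (μ := μ) w] with x hincl hTwo hOne
  rw [hincl, hTwo, hOne]

/-- Convolution on the right by a continuous function as an operator on `L²(G)`. -/
noncomputable def convLTwo (w : C(G, ℂ)) : Lp ℂ 2 μ →L[ℂ] Lp ℂ 2 μ :=
  (toLTwo μ).comp ((convContinuous w).comp lTwoInclusion)

theorem convLTwo_apply (w : C(G, ℂ)) (g : Lp ℂ 2 μ) :
    convLTwo w g = toLTwo μ (convContinuous w (lTwoInclusion g)) := rfl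

theorem lTwoInclusion_convLTwo (w : C(G, ℂ)) (g : Lp ℂ 2 μ) :
    lTwoInclusion (convLTwo w g) = conv (lTwoInclusion g) (toLOne μ w) := by
  rw [convLTwo_apply, lTwoInclusion_toLTwo, toLOne_convContinuous]

theorem isCompactOperator_convLTwo (w : C(G, ℂ)) : IsCompactOperator (convLTwo (μ := μ) w) := by
  have hconv : IsCompactOperator (convContinuous (μ := μ) w) :=
    isCompactOperator_integralAgainst (leftOrbit w)
  rw [convLTwo, ContinuousLinearMap.coe_comp, ContinuousLinearMap.coe_comp]
  exact (hconv.comp_clm lTwoInclusion).clm_comp (toLTwo μ)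

theorem inner_toLTwo_leftOrbit {w : C(G, ℂ)} (hw : ∀ x, starRingEnd ℂ (w x⁻¹) = w x)
    (f : Lp ℂ 2 μ) (y : G) :
    inner ℂ f (toLTwo μ (leftOrbit w y)) =
      starRingEnd ℂ (convContinuous w (lTwoInclusion f) y) := by
  rw [convContinuous_apply, ← integral_conj, L2.inner_def]
  refine integral_congr_ae ?_
  filter_upwards [toLTwo_ae_eq (μ := μ) (leftOrbit w y), lTwoInclusion_ae_eq f] with x hx hf
  have hwx : w (y⁻¹ * x) = starRingEnd ℂ (w (x⁻¹ * y)) := by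
    rw [← hw (y⁻¹ * x), mul_inv_rev, inv_inv]
  rw [hx, hf, leftOrbit_apply, RCLike.inner_apply, map_mul (starRingEnd ℂ), mul_comm, hwx]

theorem isSymmetric_convLTwo {w : C(G, ℂ)} (hw : ∀ x, starRingEnd ℂ (w x⁻¹) = w x) :
    (convLTwo (μ := μ) w).IsSymmetric := by
  intro f g
  have hright : inner ℂ f (convLTwo w g) =
      ∫ y, lTwoInclusion g y • inner ℂ f (toLTwo μ (leftOrbit w y)) ∂μ :=
    map_integralAgainst ((innerSL ℂ f).comp (toLTwo μ)) (leftOrbit w) (lTwoInclusion g)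
  change inner ℂ (convLTwo w f) g = inner ℂ f (convLTwo w g)
  rw [hright, L2.inner_def]
  refine integral_congr_ae ?_
  filter_upwards [toLTwo_ae_eq (μ := μ) (convContinuous w (lTwoInclusion f)),
    lTwoInclusion_ae_eq g] with y hf hg
  rw [inner_toLTwo_leftOrbit hw, hg, convLTwo_apply, hf, RCLike.inner_apply, smul_eq_mul]

end LTwo

section CentralElements

variable [T2Space G]

theorem IsSegalAlgebra.conv_self_mem_closure {S : Type*} [NormedAddCommGroup S] [NormedSpace ℂ S]
    {ι : S →L[ℂ] LOne μ} (h : IsSegalAlgebra ι) {u : LOne μ} (hu : u ∈ hermitianClassFunctions μ) :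
    conv u u ∈ (ι.range ⊓ convCenter μ).topologicalClosure := by
  obtain ⟨w, hclass, hherm, rfl⟩ := hu
  have hw := hclass.toLOne_mem_convCenter (μ := μ)
  set T := convLTwo (μ := μ) w
  set H₀ := (convCenter μ).comap (lTwoInclusion (μ := μ)).toLinearMap
  have : CompleteSpace H₀ :=
    (isClosed_convCenter.preimage (lTwoInclusion (μ := μ)).continuous).completeSpace_coe
  have hinv : ∀ g ∈ H₀, T g ∈ H₀ := fun g hg => by
    change lTwoInclusion (convLTwo w g) ∈ convCenter μ
    rw [lTwoInclusion_convLTwo]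
    exact conv_mem_convCenter hg hw
  have hwH₀ : toLTwo μ w ∈ H₀ := by
    change lTwoInclusion (toLTwo μ w) ∈ convCenter μ
    rwa [lTwoInclusion_toLTwo]
  have heigen : ∀ c : ℂ, c ≠ 0 → ∀ g : H₀, T.restrict hinv g = c • g →
      lTwoInclusion g.1 ∈ (ι.range ⊓ convCenter μ).topologicalClosure := fun c hc g hg => by
    refine Submodule.le_topologicalClosure _ ⟨h.mem_range_of_conv_eq_smul hw hc ?_, g.2⟩
    rw [← lTwoInclusion_convLTwo, ← map_smul]
    exact congrArg (fun v : H₀ => lTwoInclusion v.1) hg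
  have hmem := map_apply_mem_of_forall_eigenvector (T := T.restrict hinv)
    ((isCompactOperator_convLTwo w).restrict' hinv)
    ((isSymmetric_convLTwo hherm).restrict_invariant hinv) (lTwoInclusion.comp H₀.subtypeL)
    (Submodule.isClosed_topologicalClosure _) heigen ⟨toLTwo μ w, hwH₀⟩
  change lTwoInclusion (convLTwo w (toLTwo μ w)) ∈ _ at hmem
  rwa [lTwoInclusion_convLTwo, lTwoInclusion_toLTwo] at hmem

end CentralElements

end Spectral

/-! ### The splitting of the product map -/

section Average

variable {G : Type*} [TopologicalSpace G] [CompactSpace G] [MeasurableSpace G] [BorelSpace G]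
  {μ : Measure G} [IsFiniteMeasure μ] [NeZero μ]
  {X Y : Type*} [NormedAddCommGroup X] [NormedSpace ℂ X] [NormedAddCommGroup Y] [NormedSpace ℂ Y]

omit [NeZero μ] [NormedSpace ℂ X] in
theorem integrable_average_continuousMap (Φ : C(G, X)) : Integrable Φ ((μ Set.univ)⁻¹ • μ) :=
  (Φ.continuous.integrable_of_hasCompactSupport (HasCompactSupport.of_compactSpace Φ)).to_average

variable (μ) in
/-- The mean value of a continuous vector-valued function on a compact space, as a bounded operator
on the space of continuous functions. -/
noncomputable def averageCLM : C(G, X) →L[ℂ] X :=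
  LinearMap.mkContinuous
    { toFun := fun Φ => ⨍ z, Φ z ∂μ
      map_add' := fun Φ Ψ => integral_add (integrable_average_continuousMap Φ)
        (integrable_average_continuousMap Ψ)
      map_smul' := fun c Φ => integral_smul c Φ }
    1 fun Φ =>
      (norm_integral_le_of_norm_le_const (Eventually.of_forall Φ.norm_coe_le_norm)).trans (by simp)

theorem averageCLM_apply (Φ : C(G, X)) : averageCLM μ Φ = ⨍ z, Φ z ∂μ := rfl

theorem norm_averageCLM_apply_le (Φ : C(G, X)) : ‖averageCLM μ Φ‖ ≤ ‖Φ‖ :=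
  (norm_integral_le_of_norm_le_const (Eventually.of_forall Φ.norm_coe_le_norm)).trans (by simp)

variable [CompleteSpace X] [CompleteSpace Y]

theorem map_averageCLM (T : X →L[ℂ] Y) (Φ : C(G, X)) :
    T (averageCLM μ Φ) = ⨍ z, T (Φ z) ∂μ :=
  (T.integral_comp_comm (integrable_average_continuousMap Φ)).symm

end Average

section AverageGroup

variable {G : Type*} [Group G] [TopologicalSpace G] [IsTopologicalGroup G] [CompactSpace G]
  [MeasurableSpace G] [BorelSpace G] {μ : Measure G} [μ.IsHaarMeasure]
  {X : Type*} [NormedAddCommGroup X] [NormedSpace ℂ X] [CompleteSpace X]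

theorem average_integral_smul (f : LOne μ) (Θ : C(G, C(G, X))) :
    ⨍ z, ∫ y, f y • Θ y z ∂μ ∂μ = ∫ y, f y • ⨍ z, Θ y z ∂μ ∂μ := by
  have hswap := map_integralAgainst (averageCLM μ) Θ f
  have heval (z : G) : integralAgainst Θ f z = ∫ y, f y • Θ y z ∂μ :=
    map_integralAgainst (ContinuousMap.evalCLM ℂ z) Θ f
  simpa only [averageCLM_apply, heval] using hswap

end AverageGroup

namespace IsSegalAlgebra

section Diagonal

variable {G : Type*} [Group G] [TopologicalSpace G] [IsTopologicalGroup G]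
  [CompactSpace G] [MeasurableSpace G] [BorelSpace G] {μ : Measure G} [μ.IsHaarMeasure]
  {S : Type*} [NormedAddCommGroup S] [NormedSpace ℂ S] [CompleteSpace S] {ι : S →L[ℂ] LOne μ}

/-- The continuous function `z ↦ L_{z⁻¹}u ⊗ L_z v` on `G`. -/
noncomputable def diagonalOrbit (h : IsSegalAlgebra ι) (u : LOne μ) (v : S) :
    C(G, ProjTensor (LOne μ) S) :=
  ⟨fun z => ProjTensor.tmul (leftTranslate z⁻¹ u) (h.translate z v),
    (ProjTensor.tmulL.continuous.comp ((continuous_leftTranslate u).comp continuous_inv)).clm_apply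
      (h.continuous_translate v)⟩

@[simp] theorem diagonalOrbit_apply (h : IsSegalAlgebra ι) (u : LOne μ) (v : S) (z : G) :
    h.diagonalOrbit u v z = ProjTensor.tmul (leftTranslate z⁻¹ u) (h.translate z v) := rfl

theorem norm_diagonalOrbit_le (h : IsSegalAlgebra ι) (u : LOne μ) (v : S) :
    ‖h.diagonalOrbit u v‖ ≤ 1 * ‖u‖ * ‖v‖ :=
  (ContinuousMap.norm_le _ (by positivity)).2 fun z =>
    (ProjTensor.norm_tmul_le _ _).trans (by
      rw [norm_leftTranslate]
      gcongr
      exact h.norm_translate_le z v)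

/-- The tensor `∫ L_{z⁻¹}u ⊗ L_z v dz`, with respect to the normalised Haar measure, as a bounded
bilinear function of `u ∈ L¹(G)` and `v ∈ S`. -/
noncomputable def diagonal (h : IsSegalAlgebra ι) : LOne μ →L[ℂ] S →L[ℂ] ProjTensor (LOne μ) S :=
  LinearMap.mkContinuous₂
    (LinearMap.mk₂ ℂ (fun u v => averageCLM μ (h.diagonalOrbit u v))
      (fun u u' v => by
        rw [← map_add]
        congr 1
        ext z
        simp [← leftTranslateL_apply, ProjTensor.add_tmul])
      (fun c u v => by
        rw [← map_smul]
        congr 1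
        ext z
        simp [← leftTranslateL_apply, ProjTensor.smul_tmul])
      (fun u v v' => by
        rw [← map_add]
        congr 1
        ext z
        simp [ProjTensor.tmul_add])
      (fun c u v => by
        rw [← map_smul]
        congr 1
        ext z
        simp [ProjTensor.tmul_smul]))
    1 fun u v => (norm_averageCLM_apply_le _).trans (h.norm_diagonalOrbit_le u v)

theorem diagonal_apply (h : IsSegalAlgebra ι) (u : LOne μ) (v : S) :
    h.diagonal u v = averageCLM μ (h.diagonalOrbit u v) := rfl

theorem norm_diagonal_le (h : IsSegalAlgebra ι) (u : LOne μ) : ‖h.diagonal u‖ ≤ ‖u‖ :=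
  (h.diagonal.le_of_opNorm_le (LinearMap.mkContinuous₂_norm_le _ zero_le_one _) u).trans_eq
    (one_mul _)

theorem map_diagonal (h : IsSegalAlgebra ι) {T : LOne μ →L[ℂ] LOne μ} {U : S →L[ℂ] S}
    (hT : ∀ z f, T (leftTranslate z f) = leftTranslate z (T f))
    (hU : ∀ z s, U (h.translate z s) = h.translate z (U s)) (u : LOne μ) (v : S) :
    ProjTensor.map T U (h.diagonal u v) = h.diagonal (T u) (U v) := by
  rw [diagonal_apply, map_averageCLM, diagonal_apply, averageCLM_apply]
  simp only [diagonalOrbit_apply, ProjTensor.map_tmul, hT, hU]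

theorem tensorLeft_diagonal (h : IsSegalAlgebra ι) (f u : LOne μ) (v : S) :
    h.tensorLeft f (h.diagonal u v) = h.diagonal u (h.leftAct f v) := by
  let Θ : C(G, C(G, ProjTensor (LOne μ) S)) := ContinuousMap.curry
    ⟨fun p => ProjTensor.tmul (leftTranslate (p.1 * p.2⁻¹) u) (h.translate p.2 v),
      (ProjTensor.tmulL.continuous.comp ((continuous_leftTranslate u).comp (by fun_prop))).clm_apply
        ((h.continuous_translate v).comp continuous_snd)⟩
  have hconv (z : G) : ProjTensor.tmul (conv f (leftTranslate z⁻¹ u)) (h.translate z v)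
      = ∫ y, f y • Θ y z ∂μ := by
    rw [← ProjTensor.tmulL_apply, ← ContinuousLinearMap.flip_apply, map_conv]
    simp only [← leftTranslate_mul]
    rfl
  have hshift (y : G) : ⨍ z, Θ y z ∂μ = h.diagonal u (h.translate y v) := by
    have hval (z : G) : Θ y (z * y) = h.diagonalOrbit u (h.translate y v) z := by
      change ProjTensor.tmul (leftTranslate (y * (z * y)⁻¹) u) (h.translate (z * y) v) = _
      rw [mul_inv_rev, mul_inv_cancel_left, translate_mul, diagonalOrbit_apply]
    rw [diagonal_apply, averageCLM_apply, average,
      ← integral_mul_right_eq_self (μ := (μ Set.univ)⁻¹ • μ) (Θ y) y]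
    simp only [hval, average]
  calc h.tensorLeft f (h.diagonal u v)
      = ⨍ z, ProjTensor.tmul (conv f (leftTranslate z⁻¹ u)) (h.translate z v) ∂μ := by
        rw [diagonal_apply, map_averageCLM]
        simp only [tensorLeft, diagonalOrbit_apply, ProjTensor.map_tmul,
          ContinuousLinearMap.id_apply]
    _ = ∫ y, f y • h.diagonal u (h.translate y v) ∂μ := by
        simp only [hconv, average_integral_smul, hshift]
    _ = h.diagonal u (h.leftAct f v) := by
        rw [leftAct_eq_integral,
          ← (h.diagonal u).integral_comp_comm (h.integrable_smul_translate f v)]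
        simp only [map_smul]

theorem diagonal_leftAct_of_mem_convCenter (h : IsSegalAlgebra ι) {c : LOne μ}
    (hc : c ∈ convCenter μ) (u : LOne μ) (v : S) :
    h.diagonal u (h.leftAct c v) = h.diagonal (conv c u) v := by
  have hcomm (z : G) (f : LOne μ) :
      conv c (leftTranslate z f) = leftTranslate z (conv c f) := by
    rw [mem_convCenter.1 hc, conv_leftTranslate_left, mem_convCenter.1 hc]
  rw [← tensorLeft_diagonal, tensorLeft, h.map_diagonal hcomm fun _ _ => rfl,
    ContinuousLinearMap.id_apply]

theorem prodMap_diagonal (h : IsSegalAlgebra ι) {u : LOne μ} (hu : u ∈ convCenter μ) (v : S) :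
    h.prodMap (h.diagonal u v) = h.leftAct u v := by
  have hconst (z : G) : h.leftAct (leftTranslate z⁻¹ u) (h.translate z v) = h.leftAct u v :=
    h.injective (by
      rw [leftAct_spec, leftAct_spec, translate_spec, conv_leftTranslate_left,
        mem_convCenter.1 hu, conv_leftTranslate_left, ← leftTranslate_mul, inv_mul_cancel,
        leftTranslate_one, ← mem_convCenter.1 hu])
  rw [diagonal_apply, map_averageCLM]
  simp only [prodMap, diagonalOrbit_apply, ProjTensor.lift_tmul, hconst]
  exact average_const μ _

end Diagonal
end IsSegalAlgebra

namespace IsSegalAlgebra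

section Center

variable {G : Type*} [Group G] [TopologicalSpace G] [IsTopologicalGroup G]
  [LocallyCompactSpace G] [MeasurableSpace G] [BorelSpace G]
  {μ : Measure G} [μ.IsHaarMeasure] [μ.Regular]
  {S : Type*} [NormedAddCommGroup S] [NormedSpace ℂ S] {ι : S →L[ℂ] LOne μ}

theorem mul_comm_of_mem_convCenter (h : IsSegalAlgebra ι) {u : S} (hu : ι u ∈ convCenter μ)
    (s : S) : h.mul u s = h.mul s u :=
  h.injective (by rw [mul_spec, mul_spec, mem_convCenter.1 hu])

theorem map_mul_map_leftAct_flip (h : IsSegalAlgebra ι) (u s : S)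
    (t : ProjTensor (LOne μ) S) :
    ProjTensor.map (h.mul s) (ContinuousLinearMap.id ℂ S)
        (ProjTensor.map (h.leftAct.flip u) (ContinuousLinearMap.id ℂ S) t)
      = ProjTensor.map (h.leftAct.flip u) (ContinuousLinearMap.id ℂ S) (h.tensorLeft (ι s) t) := by
  have hcomp : (h.mul s).comp (h.leftAct.flip u) = (h.leftAct.flip u).comp (conv (ι s)) :=
    ContinuousLinearMap.ext fun f => (h.leftAct_conv (ι s) f u).symm
  rw [tensorLeft, ProjTensor.map_map, ProjTensor.map_map, hcomp]

variable [CompleteSpace S]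

theorem lift_mul_map_leftAct_flip (h : IsSegalAlgebra ι) {u : S} (hu : ι u ∈ convCenter μ)
    (t : ProjTensor (LOne μ) S) :
    ProjTensor.lift h.mul (ProjTensor.map (h.leftAct.flip u) (ContinuousLinearMap.id ℂ S) t)
      = h.mul u (h.prodMap t) := by
  have hcomp : (ProjTensor.lift h.mul).comp
      (ProjTensor.map (h.leftAct.flip u) (ContinuousLinearMap.id ℂ S))
        = (h.mul u).comp h.prodMap :=
    ProjTensor.ext_clm fun g s => by
      simp [prodMap, mul_apply, leftAct_spec, ← leftAct_conv, mem_convCenter.1 hu]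
  exact DFunLike.congr_fun hcomp t

end Center

section CompactGroup

variable {G : Type*} [Group G] [TopologicalSpace G] [IsTopologicalGroup G]
  [CompactSpace G] [MeasurableSpace G] [BorelSpace G] {μ : Measure G} [μ.IsHaarMeasure]
  {S : Type*} [NormedAddCommGroup S] [NormedSpace ℂ S] [CompleteSpace S] {ι : S →L[ℂ] LOne μ}

theorem tendsto_leftAct_centralBumps (h : IsSegalAlgebra ι) (s : S) :
    Tendsto (fun w => h.leftAct w s) (centralBumps μ) (𝓝 s) :=
  (h.tendsto_leftAct_bumps s).mono_left inf_le_left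

variable [T2Space G]

theorem exists_central_norm_lt_dist_mul_lt (h : IsSegalAlgebra ι) (F : Finset S) {ε : ℝ}
    (hε : 0 < ε) :
    ∃ u : S, ι u ∈ convCenter μ ∧ ‖ι u‖ < 2 ∧ ∀ s ∈ F, dist (h.mul u s) s < ε := by
  set V : Set (LOne μ) := {f | ‖f‖ < 2 ∧ ∀ s ∈ F, dist (h.leftAct f s) s < ε}
  have hV : IsOpen V := by
    refine isOpen_iff_eventually.2 fun f ⟨hf, hfF⟩ =>
      ((continuous_norm.tendsto f).eventually_lt_const hf).and
        ((Finset.eventually_all F).2 fun s hs => ?_)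
    exact (((h.leftAct.flip s).continuous.dist continuous_const).tendsto f).eventually_lt_const
      (hfF s hs)
  have hsquare (s : S) : Tendsto (fun w => h.leftAct (conv w w) s) (centralBumps μ) (𝓝 s) := by
    simp only [leftAct_conv]
    exact tendsto_apply_of_eventually_norm_le
      (eventually_centralBumps_norm_le_one.mono fun w hw => (h.norm_leftAct_le w).trans hw)
      (h.tendsto_leftAct_centralBumps s) (h.tendsto_leftAct_centralBumps s)
  have hsquareV : ∀ᶠ w in centralBumps μ, conv w w ∈ V := by
    refine Eventually.and (eventually_centralBumps_norm_le_one.mono fun w hw => ?_)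
      ((Finset.eventually_all F).2 fun s _ => Metric.tendsto_nhds.1 (hsquare s) ε hε)
    exact ((norm_conv_le w w).trans (mul_le_one₀ hw (norm_nonneg w) hw)).trans_lt one_lt_two
  obtain ⟨w, hwV, hw⟩ :=
    (hsquareV.and eventually_centralBumps_mem_hermitianClassFunctions).exists
  obtain ⟨_, hnear, ⟨u, rfl⟩, hu⟩ :=
    mem_closure_iff.1 (h.conv_self_mem_closure hw) V hV hwV
  exact ⟨u, hu, hnear⟩

theorem exists_central_approximate_identity (h : IsSegalAlgebra ι) :
    ∃ u : Finset S × ℕ → S, (∀ γ, ι (u γ) ∈ convCenter μ) ∧ (∀ γ, ‖ι (u γ)‖ ≤ 2) ∧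
      ∀ s, Tendsto (fun γ => h.mul (u γ) s) atTop (𝓝 s) := by
  choose u hcenter hnorm hdist using fun γ : Finset S × ℕ =>
    h.exists_central_norm_lt_dist_mul_lt γ.1 (Nat.one_div_pos_of_nat (α := ℝ) (n := γ.2))
  refine ⟨u, hcenter, fun γ => (hnorm γ).le, fun s => Metric.tendsto_nhds.2 fun ε hε => ?_⟩
  obtain ⟨n, hn⟩ := exists_nat_one_div_lt hε
  filter_upwards [Ici_mem_atTop (({s}, n) : Finset S × ℕ)] with γ hγ
  exact (hdist γ s (hγ.1 (Finset.mem_singleton_self s))).trans_le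
    ((Nat.one_div_le_one_div hγ.2).trans hn.le)

theorem dense_leftAct_convCenter (h : IsSegalAlgebra ι) :
    Dense {s | ∃ c ∈ convCenter μ, ∃ v, h.leftAct c v = s} := fun s =>
  mem_closure_of_tendsto (h.tendsto_leftAct_centralBumps s)
    (eventually_centralBumps_mem_convCenter.mono fun w hw => ⟨w, hw, s, rfl⟩)

theorem exists_clm_tendsto_diagonal (h : IsSegalAlgebra ι) :
    ∃ ρ : S →L[ℂ] ProjTensor (LOne μ) S,
      ∀ s, Tendsto (fun u => h.diagonal u s) (centralBumps μ) (𝓝 (ρ s)) := by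
  refine exists_clm_tendsto_of_dense (C := 1)
    (eventually_centralBumps_norm_le_one.mono fun u hu => (h.norm_diagonal_le u).trans hu)
    h.dense_leftAct_convCenter ?_
  rintro _ ⟨c, hc, v, rfl⟩
  have hconv : Tendsto (fun u => conv u c) (centralBumps μ) (𝓝 c) :=
    (tendsto_conv_bumps c).mono_left inf_le_left
  refine ⟨h.diagonal c v, (((h.diagonal.flip v).continuous.tendsto c).comp hconv).congr fun u => ?_⟩
  rw [h.diagonal_leftAct_of_mem_convCenter hc, mem_convCenter.1 hc]
  rfl

theorem exists_splitting (h : IsSegalAlgebra ι) :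
    ∃ ρ : S →L[ℂ] ProjTensor (LOne μ) S,
      (∀ f s, ρ (h.leftAct f s) = h.tensorLeft f (ρ s)) ∧
      (∀ U : S →L[ℂ] S, (∀ z s, U (h.translate z s) = h.translate z (U s)) →
        ∀ s, ρ (U s) = ProjTensor.map (ContinuousLinearMap.id ℂ (LOne μ)) U (ρ s)) ∧
      ∀ s, h.prodMap (ρ s) = s := by
  obtain ⟨ρ, hρ⟩ := h.exists_clm_tendsto_diagonal
  refine ⟨ρ, fun f s => ?_, fun U hU s => ?_, fun s => ?_⟩
  · refine tendsto_nhds_unique (hρ _)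
      ((((h.tensorLeft f).continuous.tendsto _).comp (hρ s)).congr fun u => ?_)
    exact h.tensorLeft_diagonal f u s
  · refine tendsto_nhds_unique (hρ _)
      ((((ProjTensor.map _ U).continuous.tendsto _).comp (hρ s)).congr fun u => ?_)
    exact h.map_diagonal (fun _ _ => rfl) hU u s
  · refine tendsto_nhds_unique ((h.prodMap.continuous.tendsto _).comp (hρ s))
      ((h.tendsto_leftAct_centralBumps s).congr' ?_)
    exact eventually_centralBumps_mem_convCenter.mono fun u hu => (h.prodMap_diagonal hu s).symm

theorem exists_mul_splitting (h : IsSegalAlgebra ι) :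
    ∃ ρ : S →L[ℂ] ProjTensor (LOne μ) S,
      (∀ s t, ρ (h.mul s t) = h.tensorLeft (ι s) (ρ t)) ∧
      (∀ s t, ρ (h.mul s t) = h.tensorRight t (ρ s)) ∧
      ∀ s, h.prodMap (ρ s) = s := by
  obtain ⟨ρ, hleft, hcomm, hsplit⟩ := h.exists_splitting
  refine ⟨ρ, fun s => hleft (ι s), fun s t => hcomm (h.mul.flip t) (fun z r => ?_) s, hsplit⟩
  change h.mul (h.translate z r) t = h.translate z (h.mul r t)
  rw [mul_apply, mul_apply, translate_leftAct, translate_spec]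

theorem hasCentralMultiplierBoundedApproximateDiagonal_of_compactSpace (h : IsSegalAlgebra ι) :
    h.HasCentralMultiplierBoundedApproximateDiagonal := by
  classical
  obtain ⟨u, hcenter, hnorm, hlim⟩ := h.exists_central_approximate_identity
  obtain ⟨ρ, hleft, hright, hsplit⟩ := h.exists_mul_splitting
  have hcentral γ s : h.tensorLeft (ι s) (ρ (u γ)) = h.tensorRight s (ρ (u γ)) := by
    rw [← hleft, ← hright, h.mul_comm_of_mem_convCenter (hcenter γ)]
  have hbound γ s : ‖h.tensorRight s (ρ (u γ))‖ ≤ ‖ρ‖ * 2 * ‖s‖ := by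
    rw [← hright, mul_assoc]
    refine ρ.le_opNorm_of_le (((h.leftAct _).le_of_opNorm_le ?_ s))
    exact (h.norm_leftAct_le _).trans (hnorm γ)
  refine ⟨Finset S × ℕ, inferInstance, inferInstance, inferInstance, fun γ => ρ (u γ),
    ⟨hcentral, fun s => ?_, fun s => ?_⟩, ‖ρ‖ * 2, fun γ s => ⟨?_, hbound γ s⟩⟩
  · simpa only [hsplit] using hlim s
  · simpa only [hsplit, h.mul_comm_of_mem_convCenter (hcenter _)] using hlim s
  · exact hcentral γ s ▸ hbound γ s

theorem isPseudoContractible_of_compactSpace (h : IsSegalAlgebra ι) :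
    IsPseudoContractible h.mul := by
  classical
  obtain ⟨u, hcenter, hnorm, hlim⟩ := h.exists_central_approximate_identity
  obtain ⟨ρ, hleft, hright, hsplit⟩ := h.exists_mul_splitting
  refine ⟨Finset S × ℕ, inferInstance, inferInstance, inferInstance, fun γ =>
    ProjTensor.map (h.leftAct.flip (u γ)) (ContinuousLinearMap.id ℂ S) (ρ (u γ)),
    fun γ s => ?_, fun s => ?_⟩
  · rw [h.map_mul_map_leftAct_flip, ← hleft, ← h.mul_comm_of_mem_convCenter (hcenter γ), hright,
      tensorRight, ProjTensor.map_map, ProjTensor.map_map]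
    rfl
  · have hmul γ : h.mul (h.mul (u γ) (u γ)) s = h.leftAct (ι (u γ)) (h.mul (u γ) s) := by
      rw [mul_apply, mul_spec, leftAct_conv, mul_apply]
    simp only [h.lift_mul_map_leftAct_flip (hcenter _), hsplit, hmul]
    exact tendsto_apply_of_eventually_norm_le
      (Eventually.of_forall fun γ => (h.norm_leftAct_le _).trans (hnorm γ)) (hlim s) (hlim s)

end CompactGroup

end IsSegalAlgebra

theorem IsSymmetricSegalAlgebra.isProjectiveBimodule_of_compactSpace
    {G : Type*} [Group G] [TopologicalSpace G] [IsTopologicalGroup G] [CompactSpace G] [T2Space G]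
    [MeasurableSpace G] [BorelSpace G] {μ : Measure G} [μ.IsHaarMeasure]
    {S : Type*} [NormedAddCommGroup S] [NormedSpace ℂ S] [CompleteSpace S] {ι : S →L[ℂ] LOne μ}
    (h : IsSymmetricSegalAlgebra ι) : h.IsProjectiveBimodule := by
  obtain ⟨ρ, hleft, hcomm, hsplit⟩ := h.toIsSegalAlgebra.exists_splitting
  refine ⟨ρ, hleft, fun f => hcomm (h.rightAct f) fun z s => h.injective ?_, hsplit⟩
  rw [rightAct_spec, h.translate_spec, h.translate_spec, conv_leftTranslate_left, rightAct_spec]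

theorem mainTheorem6 {G : Type*} [Group G] [TopologicalSpace G] [IsTopologicalGroup G]
    [LocallyCompactSpace G] [T2Space G] [MeasurableSpace G] [BorelSpace G]
    (μ : Measure G) [μ.IsHaarMeasure] [μ.Regular]
    {S : Type*} [NormedAddCommGroup S] [NormedSpace ℂ S] [CompleteSpace S]
    (ι : S →L[ℂ] LOne μ) (hS : IsSegalAlgebra ι) :
    List.TFAE [CompactSpace G,
      hS.HasCentralApproximateDiagonal,
      IsPseudoContractible hS.mul] ∧
    ∀ hsym : IsSymmetricSegalAlgebra ι,
      List.TFAE [CompactSpace G,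
        hS.HasCentralApproximateDiagonal,
        IsPseudoContractible hS.mul,
        hsym.IsProjectiveBimodule,
        hS.HasCentralMultiplierBoundedApproximateDiagonal] := by
  have h13 : CompactSpace G → IsPseudoContractible hS.mul :=
    fun _ => hS.isPseudoContractible_of_compactSpace
  have h32 := hS.hasCentralApproximateDiagonal_of_isPseudoContractible
  have h21 := hS.compactSpace_of_hasCentralApproximateDiagonal
  refine ⟨?_, fun hsym => ?_⟩
  · tfae_have 1 → 3 := h13
    tfae_have 3 → 2 := h32
    tfae_have 2 → 1 := h21
    tfae_finish
  · tfae_have 1 → 3 := h13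
    tfae_have 3 → 2 := h32
    tfae_have 2 → 1 := h21
    tfae_have 1 → 4 := fun _ => hsym.isProjectiveBimodule_of_compactSpace
    tfae_have 4 → 1 := hsym.compactSpace_of_isProjectiveBimodule
    tfae_have 1 → 5 := fun _ => hS.hasCentralMultiplierBoundedApproximateDiagonal_of_compactSpace
    tfae_have 5 → 2 := fun ⟨Γ, i₁, i₂, i₃, m, hm, _⟩ => ⟨Γ, i₁, i₂, i₃, m, hm⟩
    tfae_finish
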